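/- Fix a field $K$. For a finite simple graph $G$ with vertex set $[n]=\{1,\dots,n\}$, let $I(G)=(x_ix_j \mid \{i,j\}\in E(G))\subset K[x_1,\dots,x_n]$ be its edge ideal. Let $G(n,p)$ be the Erdős–Rényi random graph on $[n]$, in which each pair of distinct vertices is an edge with probability $p$, independently of all other pairs, and let $I(n,p)=I(G(n,p))$. An ideal $I$ of $S=K[x_1,\dots,x_n]$ is called unmixed if all associated primes of $S/I$ are minimal over $I$ and have the same height. For a sequence $p=p(n)$, a property holds with high probability (w.h.p.) if its probability tends to $1$ as $n\to\infty$; in particular, "$I(n,p)$ is not unmixed w.h.p." means $\mathbb P(I(n,p)\text{ is not unmixed})\to 1$. 1. If $p=n^{-\alpha}$ with $\alpha\in(\tfrac32,2)$, then $I(n,p)$ is unmixed w.h.p. 2. If $p=n^{-\alpha}$ with $\alpha\in[1,\tfrac32)$, then $I(n,p)$ is not unmixed w.h.p. 3. If $p\in(0,1)$ is a constant, then $I(n,p)$ is not unmixed w.h.p. 4. If $p=1-n^{-\alpha}$ with $\alpha\in(0,2)$ and $\alpha^{-1}\notin\{2,3,\dots\}$, then $I(n,p)$ is not unmixed w.h.p.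 5. If $p=1-n^{-\alpha}$ with $\alpha>2$, then $I(n,p)$ is unmixed w.h.p. -/

import Mathlib

open Filter Topology
open scoped ProbabilityTheory

/-- The edge ideal `I(G) = (x_i x_j | {i, j} ∈ E(G))` of a simple graph `G` on the vertex set `V`,
in the polynomial ring over `K` with one variable for each vertex. -/
noncomputable def SimpleGraph.edgeIdeal (K : Type*) [Field K] {V : Type*} (G : SimpleGraph V) :
    Ideal (MvPolynomial V K) :=
  Ideal.span {f | ∃ i j : V, G.Adj i j ∧ f = MvPolynomial.X i * MvPolynomial.X j}

/-- An ideal `I` is unmixed if all its associated primes (the associated primes of the module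
`R ⧸ I`) are minimal over `I`, and all of them have the same height. -/
structure Ideal.IsUnmixed {R : Type*} [CommRing R] (I : Ideal R) : Prop where
  mem_minimalPrimes : ∀ P ∈ associatedPrimes R (R ⧸ I), P ∈ I.minimalPrimes
  height_eq : ∀ P ∈ associatedPrimes R (R ⧸ I), ∀ Q ∈ associatedPrimes R (R ⧸ I),
    P.height = Q.height

/-- The law of the Erdős–Rényi random graph `G(n, p)` on `n` labelled vertices: each pair of
distinct vertices is an edge with probability `p`, independently of the other pairs. The parameter
is a real number; values outside `[0, 1]` are replaced by the nearest point of `[0, 1]`. -/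
noncomputable def erdosRenyi (n : ℕ) (p : ℝ) : MeasureTheory.Measure (SimpleGraph (Fin n)) :=
  SimpleGraph.binomialRandom (Fin n) (Set.projIcc 0 1 zero_le_one p)

/-- For a sequence `p = p(n)`, the random graph `G(n, p(n))` has the property `Q` with high
probability: the probability that it has `Q` tends to `1` as `n → ∞`. -/
def WithHighProbability (p : ℕ → ℝ) (Q : ∀ n : ℕ, SimpleGraph (Fin n) → Prop) : Prop :=
  Tendsto (fun n : ℕ => erdosRenyi n (p n) {G | Q n G}) atTop (𝓝 1)

/-!
# Unmixedness of the edge ideal of a random graph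

The edge ideal of a graph is the intersection of the primes generated by its vertex covers, hence
radical, and its associated primes are the primes generated by the complements of the maximal
independent sets. Such a prime has as height its number of variables, so the edge ideal is unmixed
iff all maximal independent sets have the same size (`SimpleGraph.edgeIdeal_isUnmixed_iff`). What
remains is a statement about random graphs.

* A disjoint union of cliques has maximal independent sets of one size only. For `p = n ^ (-α)` with
  `α > 3 / 2` the graph is a matching, and for `p = 1 - n ^ (-α)` with `α > 2` it is complete, in
  both cases by a union bound.
* For `p = n ^ (-α)` with `1 ≤ α < 3 / 2` there is a connected component that is a path on three
  vertices. In a maximal independent set its centre can be exchanged for its two ends.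
* In the remaining regimes there are maximal independent sets of two consecutive sizes. Write
  `q = 1 - p`. A set of `k` vertices that is independent fails to be maximal with probability at
  most `n * q ^ k`, and independent `k`-sets exist by the second moment method if
  `k ^ 2 * q ^ (-(k - 1) / 2) / n` tends to zero (`withHighProbability_exists_isMaxIndep`). The
  second moment is summed over the transversals of `k` disjoint blocks of vertices only: the number
  of agreements of two random transversals is a binomial variable, and its generating function is
  explicit. For constant `p` the size is of order `log n`, and for `p = 1 - n ^ (-α)` it is constant.
  The only case outside the reach of this criterion is the size `1` for `α = 1`, where the second
  moment method is applied directly to the vertices adjacent to all others.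

The second moment method is used in the form `sq_sum_measureReal_le`, which bounds the probability
of a union of events from below by means of the probabilities of their pairwise intersections.
-/

/-! ### Maximal independent sets and the associated primes of an edge ideal -/

section EdgeIdeal

variable {V : Type*} (K : Type*) [Field K]

/-- A set of vertices is a maximal independent set if it is independent and each vertex outside of
it has a neighbour in it. -/
structure SimpleGraph.IsMaxIndep (G : SimpleGraph V) (A : Finset V) : Prop where
  not_adj : ∀ a ∈ A, ∀ b ∈ A, ¬ G.Adj a b
  exists_adj : ∀ v, v ∉ A → ∃ a ∈ A, G.Adj v a

theorem Ideal.mem_colon_mk {R : Type*} [CommRing R] {I : Ideal R} {f g : R} :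
    f ∈ Submodule.colon (⊥ : Submodule R (R ⧸ I)) {Ideal.Quotient.mk I g} ↔ f * g ∈ I :=
  Submodule.mem_colon_singleton.trans
    ((Submodule.mem_bot _).trans (Ideal.Quotient.eq_zero_iff_mem (a := f * g)))

theorem MvPolynomial.isPrime_span_X_image (C : Set V) :
    (Ideal.span (X '' C : Set (MvPolynomial V K))).IsPrime := by
  classical
  let φ : MvPolynomial V K →ₐ[K] MvPolynomial V K := aeval fun i => if i ∈ C then 0 else X i
  -- The span is the kernel of the substitution `φ`, which sets the variables in `C` to zero.
  have hφ : Ideal.span (X '' C : Set (MvPolynomial V K)) = RingHom.ker φ := by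
    apply le_antisymm
    · rw [Ideal.span_le]
      rintro _ ⟨i, hi, rfl⟩
      simp [φ, RingHom.mem_ker, hi]
    · intro f hf
      have h : (Ideal.Quotient.mkₐ K (Ideal.span (X '' C : Set (MvPolynomial V K)))).comp φ =
          Ideal.Quotient.mkₐ K _ := by
        ext i
        by_cases hi : i ∈ C
        · have : (Ideal.Quotient.mk (Ideal.span (X '' C : Set (MvPolynomial V K)))) (X i) = 0 :=
            Ideal.Quotient.eq_zero_iff_mem.2 (Ideal.subset_span ⟨i, hi, rfl⟩)
          simp [φ, hi, this]
        · simp [φ, hi]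
      have h' := DFunLike.congr_fun h f
      rw [AlgHom.comp_apply, (RingHom.mem_ker).1 hf, map_zero] at h'
      exact Ideal.Quotient.eq_zero_iff_mem.1 h'.symm
  rw [hφ]
  exact RingHom.ker_isPrime _

theorem MvPolynomial.X_mem_span_X_image {C : Set V} {i : V} :
    (X i : MvPolynomial V K) ∈ Ideal.span (X '' C : Set (MvPolynomial V K)) ↔ i ∈ C := by
  classical
  refine ⟨fun h => ?_, fun h => Ideal.subset_span ⟨i, h, rfl⟩⟩
  obtain ⟨j, hj, hij⟩ := mem_ideal_span_X_image.1 h (Finsupp.single i 1) (by simp [support_X])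
  rw [Finsupp.single_apply] at hij
  split_ifs at hij with h'
  · exact h' ▸ hj
  · simp at hij

/-- The upper bound is Krull's height theorem; the lower bound comes from the chain of primes that
adds one variable at a time. -/
theorem MvPolynomial.height_span_X_image [Finite V] (C : Finset V) :
    (Ideal.span (X '' (C : Set V) : Set (MvPolynomial V K))).height = C.card := by
  classical
  apply le_antisymm
  · have := isPrime_span_X_image K (C : Set V)
    have h : (C.image (X : V → MvPolynomial V K) : Set (MvPolynomial V K)) = X '' (C : Set V) := by
      simp
    have h2 : Ideal.span (X '' (C : Set V) : Set (MvPolynomial V K)) ∈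
        (Ideal.span (C.image (X : V → MvPolynomial V K) :
          Set (MvPolynomial V K))).minimalPrimes := by
      rw [h, Ideal.minimalPrimes_eq_subsingleton_self]
      rfl
    refine (Ideal.height_le_card_of_mem_minimalPrimes_span_finset h2).trans ?_
    exact_mod_cast Finset.card_image_le
  · induction C using Finset.induction_on with
    | empty => simp
    | insert c C hc ih =>
      have := isPrime_span_X_image K (C : Set V)
      have := isPrime_span_X_image K ((insert c C : Finset V) : Set V)
      have hlt : Ideal.span (X '' (C : Set V) : Set (MvPolynomial V K)) <
          Ideal.span (X '' ((insert c C : Finset V) : Set V)) := by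
        refine lt_of_le_not_ge (Ideal.span_mono (Set.image_mono (by simp))) fun h => hc ?_
        have := h ((X_mem_span_X_image K).2 (Finset.mem_coe.2 (Finset.mem_insert_self c C)))
        exact Finset.mem_coe.1 ((X_mem_span_X_image K).1 this)
      rw [Finset.card_insert_of_notMem hc]
      rw [Nat.cast_add, Nat.cast_one]
      exact (add_le_add_left ih 1).trans (Ideal.height_add_one_le_of_lt_of_isPrime hlt)

namespace SimpleGraph

variable {K} (G : SimpleGraph V)

/-- A polynomial lies in the edge ideal iff the support of each of its monomials contains an
edge. -/
theorem mem_edgeIdeal {f : MvPolynomial V K} :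
    f ∈ G.edgeIdeal K ↔ ∀ m ∈ f.support, ∃ i j, G.Adj i j ∧ m i ≠ 0 ∧ m j ≠ 0 := by
  classical
  have h : {f : MvPolynomial V K | ∃ i j, G.Adj i j ∧ f = MvPolynomial.X i * MvPolynomial.X j} =
      (fun s => MvPolynomial.monomial s (1 : K)) ''
        {s | ∃ i j, G.Adj i j ∧ s = Finsupp.single i 1 + Finsupp.single j 1} := by
    ext f
    constructor
    · rintro ⟨i, j, hij, rfl⟩
      exact ⟨_, ⟨i, j, hij, rfl⟩, by simp [MvPolynomial.X, MvPolynomial.monomial_mul]⟩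
    · rintro ⟨_, ⟨i, j, hij, rfl⟩, rfl⟩
      exact ⟨i, j, hij, by simp [MvPolynomial.X, MvPolynomial.monomial_mul]⟩
  rw [edgeIdeal, h, MvPolynomial.mem_ideal_span_monomial_image]
  refine forall₂_congr fun m _ => ⟨?_, ?_⟩
  · rintro ⟨_, ⟨i, j, hij, rfl⟩, hm⟩
    refine ⟨i, j, hij, ?_, ?_⟩
    · have := hm i
      simp at this
      omega
    · have := hm j
      simp at this
      omega
  · rintro ⟨i, j, hij, hi, hj⟩
    refine ⟨_, ⟨i, j, hij, rfl⟩, fun v => ?_⟩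
    have hne := hij.ne
    simp only [Finsupp.coe_add, Pi.add_apply, Finsupp.single_apply]
    by_cases h1 : i = v <;> by_cases h2 : j = v <;> simp_all <;> omega

/-- The prime generated by the variables of a vertex cover contains the edge ideal. -/
theorem edgeIdeal_le_span_X_image {C : Set V} (hC : ∀ i j, G.Adj i j → i ∈ C ∨ j ∈ C) :
    G.edgeIdeal K ≤ Ideal.span (MvPolynomial.X '' C) := by
  rw [edgeIdeal, Ideal.span_le]
  rintro _ ⟨i, j, hij, rfl⟩
  rcases hC i j hij with h | h
  · exact Ideal.mul_mem_right _ _ (Ideal.subset_span ⟨i, h, rfl⟩)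
  · exact Ideal.mul_mem_left _ _ (Ideal.subset_span ⟨j, h, rfl⟩)

variable [Fintype V] [DecidableEq V]

/-- The edge ideal is the intersection of the primes generated by the vertex covers. -/
theorem edgeIdeal_eq_inf (G : SimpleGraph V) :
    G.edgeIdeal K = ⨅ C ∈ {C : Finset V | ∀ i j, G.Adj i j → i ∈ C ∨ j ∈ C},
      Ideal.span (MvPolynomial.X '' (C : Set V)) := by
  apply le_antisymm
  · exact le_iInf₂ fun C hC => G.edgeIdeal_le_span_X_image hC
  · intro f hf
    rw [mem_edgeIdeal]
    intro m hm
    by_contra! hcon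
    -- If the support of `m` is independent, then its complement is a vertex cover.
    have h1 : ∀ i j, G.Adj i j → i ∈ m.supportᶜ ∨ j ∈ m.supportᶜ := by
      intro i j hij
      have := hcon i j hij
      simp only [Finset.mem_compl, Finsupp.mem_support_iff, not_not]
      tauto
    have h2 := (Submodule.mem_iInf _).1 ((Submodule.mem_iInf _).1 hf m.supportᶜ) h1
    obtain ⟨i, hi, hmi⟩ := MvPolynomial.mem_ideal_span_X_image.1 h2 m hm
    simp at hi
    exact hmi hi

theorem edgeIdeal_isRadical (G : SimpleGraph V) : (G.edgeIdeal K).IsRadical := by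
  rw [edgeIdeal_eq_inf]
  intro f hf
  obtain ⟨n, hn⟩ := hf
  simp only [Submodule.mem_iInf] at hn ⊢
  intro C hC
  exact (MvPolynomial.isPrime_span_X_image K (C : Set V)).mem_of_pow_mem n (hn C hC)

theorem IsMaxIndep.span_mem_associatedPrimes {G : SimpleGraph V} {A : Finset V}
    (hA : G.IsMaxIndep A) :
    Ideal.span (MvPolynomial.X '' ((Aᶜ : Finset V) : Set V)) ∈
      associatedPrimes (MvPolynomial V K) (MvPolynomial V K ⧸ G.edgeIdeal K) := by
  have hp := MvPolynomial.isPrime_span_X_image K ((Aᶜ : Finset V) : Set V)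
  have hcov : ∀ i j, G.Adj i j →
      i ∈ ((Aᶜ : Finset V) : Set V) ∨ j ∈ ((Aᶜ : Finset V) : Set V) := by
    intro i j hij
    by_contra! h
    simp only [Finset.coe_compl, Set.mem_compl_iff, Finset.mem_coe, not_not] at h
    exact hA.not_adj i h.1 j h.2 hij
  rw [AssociatedPrimes.mem_iff, isAssociatedPrime_iff]
  -- The prime is the annihilator of the product of the variables in `A`.
  refine ⟨hp, Ideal.Quotient.mk _ (∏ a ∈ A, MvPolynomial.X a), ?_⟩
  have key := fun f => Ideal.mem_colon_mk (I := G.edgeIdeal K) (f := f)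
    (g := ∏ a ∈ A, MvPolynomial.X a)
  apply le_antisymm
  · rw [Ideal.span_le]
    rintro _ ⟨c, hc, rfl⟩
    have hc' : c ∉ A := by simpa using hc
    obtain ⟨a, ha, hca⟩ := hA.exists_adj c hc'
    refine (key _).2 ?_
    rw [← Finset.mul_prod_erase A _ ha, ← mul_assoc]
    exact Ideal.mul_mem_right _ _ (Ideal.subset_span ⟨c, a, hca, rfl⟩)
  · intro f hf
    have h1 := G.edgeIdeal_le_span_X_image hcov ((key f).1 hf)
    refine (hp.mem_or_mem h1).resolve_right fun h2 => ?_
    obtain ⟨a, ha, h3⟩ := hp.prod_mem_iff.1 h2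
    have h4 := (MvPolynomial.X_mem_span_X_image K).1 h3
    simp at h4
    exact h4 ha

/-- Writing an associated prime as `I : f`, with `I` the intersection of the primes of vertex
covers, shows that it is the prime of a vertex cover. -/
theorem exists_eq_span_of_mem_associatedPrimes {G : SimpleGraph V} {P : Ideal (MvPolynomial V K)}
    (hP : P ∈ associatedPrimes (MvPolynomial V K) (MvPolynomial V K ⧸ G.edgeIdeal K)) :
    P ∈ (G.edgeIdeal K).minimalPrimes ∧ ∃ A : Finset V, G.IsMaxIndep A ∧
      P = Ideal.span (MvPolynomial.X '' ((Aᶜ : Finset V) : Set V)) := by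
  classical
  rw [AssociatedPrimes.mem_iff, isAssociatedPrime_iff] at hP
  obtain ⟨hp, x, hx⟩ := hP
  obtain ⟨f, rfl⟩ := Ideal.Quotient.mk_surjective x
  have key : ∀ g : MvPolynomial V K, g ∈ P ↔ g * f ∈ G.edgeIdeal K := by
    intro g
    rw [hx, Ideal.mem_colon_mk]
  have hIP : G.edgeIdeal K ≤ P := fun g hg => (key g).2 (Ideal.mul_mem_right _ _ hg)
  have hfP : f ∉ P := by
    intro h
    have h2 : f ∈ G.edgeIdeal K := G.edgeIdeal_isRadical ⟨2, by rw [pow_two]; exact (key f).1 h⟩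
    exact hp.ne_top ((Ideal.eq_top_iff_one _).2 ((key 1).2 (by simpa using h2)))
  have hmin : P ∈ (G.edgeIdeal K).minimalPrimes := by
    refine ⟨⟨hp, hIP⟩, fun Q hQ hQP g hg => ?_⟩
    exact (hQ.1.mem_or_mem (hQ.2 ((key g).1 hg))).resolve_right fun h => hfP (hQP h)
  refine ⟨hmin, ?_⟩
  -- By primality, `P` contains the prime of some vertex cover `C`; by minimality they are equal.
  obtain ⟨C, hC, hCP⟩ : ∃ C : Finset V, (∀ i j, G.Adj i j → i ∈ C ∨ j ∈ C) ∧
      Ideal.span (MvPolynomial.X '' (C : Set V)) ≤ P := by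
    have h : (Finset.univ.filter fun C : Finset V => ∀ i j, G.Adj i j → i ∈ C ∨ j ∈ C).inf
        (fun C => Ideal.span (MvPolynomial.X '' (C : Set V) : Set (MvPolynomial V K))) ≤ P := by
      refine le_trans (le_of_eq ?_) hIP
      rw [edgeIdeal_eq_inf, Finset.inf_eq_iInf]
      simp
    obtain ⟨C, hC, h⟩ := hp.inf_le'.1 h
    exact ⟨C, (Finset.mem_filter.1 hC).2, h⟩
  have hPC : P = Ideal.span (MvPolynomial.X '' (C : Set V)) :=
    le_antisymm (hmin.2 ⟨MvPolynomial.isPrime_span_X_image K _, G.edgeIdeal_le_span_X_image hC⟩ hCP)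
      hCP
  refine ⟨Cᶜ, ⟨fun a ha b hb hab => ?_, fun v hv => ?_⟩, by simpa using hPC⟩
  · rw [Finset.mem_compl] at ha hb
    exact (hC a b hab).elim ha hb
  · by_contra! hcon
    have hvC : v ∈ C := by simpa using hv
    have hcov : ∀ i j, G.Adj i j → i ∈ ((C.erase v : Finset V) : Set V) ∨
        j ∈ ((C.erase v : Finset V) : Set V) := by
      intro i j hij
      simp only [Finset.coe_erase, Set.mem_sdiff, Finset.mem_coe, Set.mem_singleton_iff]
      by_cases hi : i = v
      · subst hi
        refine Or.inr ⟨?_, hij.ne'⟩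
        by_contra hj
        exact hcon j (by simpa using hj) hij
      · by_cases hj : j = v
        · subst hj
          refine Or.inl ⟨?_, hi⟩
          by_contra h
          exact hcon i (by simpa using h) hij.symm
        · exact (hC i j hij).imp (fun h => ⟨h, hi⟩) fun h => ⟨h, hj⟩
    have h1 : P ≤ Ideal.span (MvPolynomial.X '' ((C.erase v : Finset V) : Set V)) :=
      hmin.2 ⟨MvPolynomial.isPrime_span_X_image K _, G.edgeIdeal_le_span_X_image hcov⟩
        (hPC ▸ Ideal.span_mono (Set.image_mono (by simp)))
    have h2 : (MvPolynomial.X v : MvPolynomial V K) ∈ P :=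
      hPC ▸ (MvPolynomial.X_mem_span_X_image K).2 (Finset.mem_coe.2 hvC)
    have h3 := (MvPolynomial.X_mem_span_X_image K).1 (h1 h2)
    simp at h3

/-- The edge ideal is unmixed iff the graph is well-covered. -/
theorem edgeIdeal_isUnmixed_iff (K : Type*) [Field K] (G : SimpleGraph V) :
    (G.edgeIdeal K).IsUnmixed ↔
      ∀ A B : Finset V, G.IsMaxIndep A → G.IsMaxIndep B → A.card = B.card := by
  constructor
  · intro h A B hA hB
    have h1 := h.height_eq _ hA.span_mem_associatedPrimes _ hB.span_mem_associatedPrimes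
    rw [MvPolynomial.height_span_X_image, MvPolynomial.height_span_X_image] at h1
    have h2 : Aᶜ.card = Bᶜ.card := by exact_mod_cast h1
    rw [Finset.card_compl, Finset.card_compl] at h2
    have := A.card_le_univ
    have := B.card_le_univ
    omega
  · intro h
    refine ⟨fun P hP => (exists_eq_span_of_mem_associatedPrimes hP).1, fun P hP Q hQ => ?_⟩
    obtain ⟨-, A, hA, rfl⟩ := exists_eq_span_of_mem_associatedPrimes hP
    obtain ⟨-, B, hB, rfl⟩ := exists_eq_span_of_mem_associatedPrimes hQ
    rw [MvPolynomial.height_span_X_image, MvPolynomial.height_span_X_image, Finset.card_compl,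
      Finset.card_compl, h A B hA hB]

end SimpleGraph

end EdgeIdeal

/-! ### Graphs that are, or are not, well-covered -/

namespace SimpleGraph

variable {V : Type*}

/-- In a disjoint union of cliques, each maximal independent set consists of one vertex of each
clique. -/
theorem IsMaxIndep.card_le_card {G : SimpleGraph V}
    (hG : ∀ a b c, G.Adj a b → G.Adj b c → a ≠ c → G.Adj a c) {A B : Finset V}
    (hA : G.IsMaxIndep A) (hB : G.IsMaxIndep B) : A.card ≤ B.card := by
  classical
  have h : ∀ a, ∃ b ∈ B, a = b ∨ G.Adj a b := by
    intro a
    by_cases ha : a ∈ B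
    · exact ⟨a, ha, Or.inl rfl⟩
    · obtain ⟨b, hb, hab⟩ := hB.exists_adj a ha
      exact ⟨b, hb, Or.inr hab⟩
  choose f hfB hf using h
  refine Finset.card_le_card_of_injOn f (fun a _ => hfB a) fun a ha a' ha' haa' => ?_
  by_contra hne
  refine hA.not_adj a ha a' ha' ?_
  rcases hf a with h1 | h1 <;> rcases hf a' with h2 | h2
  · exact absurd (h1.trans (haa'.trans h2.symm)) hne
  · rw [h1, haa']
    exact h2.symm
  · rw [haa', ← h2] at h1
    exact h1
  · rw [haa'] at h1
    exact hG _ _ _ h1 h2.symm hne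

theorem isUnmixed_edgeIdeal_of_adj_trans (K : Type*) [Field K] [Fintype V] [DecidableEq V]
    {G : SimpleGraph V} (hG : ∀ a b c, G.Adj a b → G.Adj b c → a ≠ c → G.Adj a c) :
    (G.edgeIdeal K).IsUnmixed :=
  (edgeIdeal_isUnmixed_iff K G).2 fun _ _ hA hB =>
    le_antisymm (hA.card_le_card hG hB) (hB.card_le_card hG hA)

/-- The path `a - c - b` is a connected component of the graph. -/
structure IsIsolatedPath (G : SimpleGraph V) (c a b : V) : Prop where
  adj_center : ∀ v, G.Adj c v ↔ v = a ∨ v = b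
  adj_left : ∀ v, G.Adj a v ↔ v = c
  adj_right : ∀ v, G.Adj b v ↔ v = c

theorem exists_isMaxIndep_mem [Fintype V] (G : SimpleGraph V) (c : V) :
    ∃ A, G.IsMaxIndep A ∧ c ∈ A := by
  classical
  obtain ⟨A, hA, hmax⟩ := (Finset.univ.filter fun A : Finset V =>
    c ∈ A ∧ ∀ a ∈ A, ∀ b ∈ A, ¬ G.Adj a b).exists_max_image Finset.card ⟨{c}, by simp⟩
  obtain ⟨-, hc, hA⟩ := Finset.mem_filter.1 hA
  refine ⟨A, ⟨hA, fun v hv => ?_⟩, hc⟩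
  by_contra! hcon
  have h := hmax (insert v A) (Finset.mem_filter.2 ⟨Finset.mem_univ _, Finset.mem_insert_of_mem hc,
    fun a ha b hb hab => ?_⟩)
  · rw [Finset.card_insert_of_notMem hv] at h
    omega
  · rw [Finset.mem_insert] at ha hb
    rcases ha with rfl | ha <;> rcases hb with rfl | hb
    · exact hab.ne rfl
    · exact hcon b hb hab
    · exact hcon a ha hab.symm
    · exact hA a ha b hb hab

/-- A maximal independent set that contains the centre of an isolated path remains maximal
independent when the centre is exchanged for the two ends. -/
theorem IsIsolatedPath.not_isUnmixed (K : Type*) [Field K] [Fintype V] [DecidableEq V]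
    {G : SimpleGraph V} {c a b : V} (h : G.IsIsolatedPath c a b) (hab : a ≠ b) :
    ¬ (G.edgeIdeal K).IsUnmixed := by
  rw [edgeIdeal_isUnmixed_iff]
  intro hwc
  obtain ⟨A, hA, hc⟩ := G.exists_isMaxIndep_mem c
  have haA : a ∉ A := fun ha => hA.not_adj c hc a ha ((h.adj_center a).2 (Or.inl rfl))
  have hbA : b ∉ A := fun hb => hA.not_adj c hc b hb ((h.adj_center b).2 (Or.inr rfl))
  have hac : a ≠ c := fun h' => haA (h' ▸ hc)
  have hbc : b ≠ c := fun h' => hbA (h' ▸ hc)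
  have hB : G.IsMaxIndep (insert a (insert b (A.erase c))) := by
    have h1 := h.adj_left
    have h2 := h.adj_right
    constructor
    · intro x hx y hy hxy
      simp only [Finset.mem_insert, Finset.mem_erase] at hx hy
      rcases hx with rfl | rfl | ⟨hxc, hx⟩
      · rw [h1] at hxy
        subst hxy
        tauto
      · rw [h2] at hxy
        subst hxy
        tauto
      · rcases hy with rfl | rfl | ⟨hyc, hy⟩
        · exact hxc ((h1 x).1 hxy.symm)
        · exact hxc ((h2 x).1 hxy.symm)
        · exact hA.not_adj x hx y hy hxy
    · intro v hv
      simp only [Finset.mem_insert, Finset.mem_erase, not_or, not_and] at hv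
      by_cases hvc : v = c
      · exact ⟨a, by simp, hvc ▸ (h.adj_center a).2 (Or.inl rfl)⟩
      · obtain ⟨w, hw, hvw⟩ := hA.exists_adj v (hv.2.2 hvc)
        refine ⟨w, ?_, hvw⟩
        have hwc : w ≠ c := by
          rintro rfl
          exact ((h.adj_center v).1 hvw.symm).elim hv.1 hv.2.1
        simp [hwc, hw]
  have h1 := hwc _ _ hA hB
  rw [Finset.card_insert_of_notMem (by simp [hab, haA]),
    Finset.card_insert_of_notMem (by simp [hbA]), Finset.card_erase_of_mem hc] at h1
  have : 0 < A.card := Finset.card_pos.2 ⟨c, hc⟩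
  omega

end SimpleGraph

/-! ### Probabilities in the random graph -/

section RandomGraph

open MeasureTheory

instance SimpleGraph.instMeasurableSingletonClass {V : Type*} [Countable V] :
    MeasurableSingletonClass (SimpleGraph V) where
  measurableSet_singleton G := by
    have h : ({G} : Set (SimpleGraph V)) = ⋂ (u : V) (v : V), {H | H.Adj u v ↔ G.Adj u v} := by
      ext H
      simp only [Set.mem_singleton_iff, Set.mem_iInter, Set.mem_ofPred_eq]
      exact ⟨fun h u v => h ▸ Iff.rfl, fun h => by ext u v; exact h u v⟩
    rw [h]
    refine MeasurableSet.iInter fun u => MeasurableSet.iInter fun v => ?_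
    measurability

instance isProbabilityMeasure_erdosRenyi (n : ℕ) (p : ℝ) :
    IsProbabilityMeasure (erdosRenyi n p) := by
  unfold erdosRenyi
  infer_instance

open unitInterval ProbabilityTheory in
theorem erdosRenyi_real_setOf (n : ℕ) {p : ℝ} (hp0 : 0 ≤ p) (hp1 : p ≤ 1)
    (E F : Finset (Sym2 (Fin n))) (hE : ∀ e ∈ E, ¬ e.IsDiag) (hF : ∀ e ∈ F, ¬ e.IsDiag)
    (hEF : Disjoint E F) :
    (erdosRenyi n p).real {G | (∀ e ∈ E, e ∈ G.edgeSet) ∧ ∀ e ∈ F, e ∉ G.edgeSet} =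
      p ^ E.card * (1 - p) ^ F.card := by
  classical
  set r : unitInterval := ⟨p, hp0, hp1⟩
  have hr : Set.projIcc 0 1 zero_le_one p = r := Set.projIcc_of_mem _ ⟨hp0, hp1⟩
  let t : Sym2 (Fin n) → Set Prop := fun e => if e ∈ E then {True} else {False}
  have key : (fun q : Sym2 (Fin n) → Prop => {e | q e}) ⁻¹' (SimpleGraph.fromEdgeSet ⁻¹'
      {G : SimpleGraph (Fin n) | (∀ e ∈ E, e ∈ G.edgeSet) ∧ ∀ e ∈ F, e ∉ G.edgeSet}) =
      Set.pi ((E ∪ F : Finset (Sym2 (Fin n))) : Set (Sym2 (Fin n))) t := by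
    ext q
    simp only [Set.mem_preimage, Set.mem_ofPred_eq, SimpleGraph.edgeSet_fromEdgeSet, Set.mem_pi,
      Finset.coe_union, Set.mem_union, Finset.mem_coe, Set.mem_sdiff, t]
    constructor
    · rintro ⟨h1, h2⟩ e he
      by_cases heE : e ∈ E
      · simpa [heE] using (h1 e heE).1
      · have heF := he.resolve_left heE
        have := h2 e heF
        have h3 := hF e heF
        simpa [heE, h3] using this
    · intro h
      refine ⟨fun e he => ⟨by simpa [he] using h e (Or.inl he), hE e he⟩, fun e he h' => ?_⟩
      have heE : e ∉ E := fun h => Finset.disjoint_left.1 hEF h he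
      have := h e (Or.inr he)
      simp [heE] at this
      exact this h'.1
  have hmeas : (erdosRenyi n p) {G | (∀ e ∈ E, e ∈ G.edgeSet) ∧ ∀ e ∈ F, e ∉ G.edgeSet} =
      ∏ e ∈ E ∪ F, (if e ∈ E then (toNNReal r : ENNReal) else (toNNReal (σ r) : ENNReal)) := by
    rw [erdosRenyi, hr, SimpleGraph.binomialRandom_eq_map,
      Measure.map_apply SimpleGraph.measurable_fromEdgeSet (Set.toFinite _).measurableSet,
      setBernoulli_apply', key, Measure.infinitePi_pi]
    · refine Finset.prod_congr rfl fun e he => ?_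
      have hd : ¬ e.IsDiag := (Finset.mem_union.1 he).elim (hE e) (hF e)
      by_cases heE : e ∈ E
      · simp [t, heE, hd]
      · simp [t, heE, hd]
    · intro e he
      exact MeasurableSet.of_discrete
  rw [measureReal_def, hmeas, Finset.prod_union hEF,
    Finset.prod_congr rfl fun e he => if_pos he,
    Finset.prod_congr (g := fun _ => (toNNReal (σ r) : ENNReal)) rfl fun e he =>
      if_neg (Finset.disjoint_right.1 hEF he)]
  simp [r]

/-- The second moment method, by the Cauchy–Schwarz inequality for the number of events that
occur. -/
theorem sq_sum_measureReal_le {Ω ι : Type*} [MeasurableSpace Ω] [DiscreteMeasurableSpace Ω]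
    (μ : Measure Ω) [IsProbabilityMeasure μ] [Fintype ι] (A : ι → Set Ω) :
    (∑ i, μ.real (A i)) ^ 2 ≤
      (∑ i, ∑ j, μ.real (A i ∩ A j)) * μ.real (⋃ i, A i) := by
  classical
  let U := ⋃ i, A i
  have hint : ∀ s : Set Ω, Integrable (s.indicator fun _ => (1 : ℝ)) μ := fun s =>
    (integrable_const 1).indicator MeasurableSet.of_discrete
  have hI : ∀ s : Set Ω, ∫ ω, s.indicator (fun _ => (1 : ℝ)) ω ∂μ = μ.real s := fun s => by
    rw [integral_indicator_const _ MeasurableSet.of_discrete, smul_eq_mul, mul_one]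
  have key : ∀ t : ℝ, 0 ≤ μ.real U * (t * t) + (-2 * ∑ i, μ.real (A i)) * t +
      ∑ i, ∑ j, μ.real (A i ∩ A j) := by
    intro t
    have h0 : 0 ≤ ∫ ω, (∑ i, (A i).indicator (fun _ => (1 : ℝ)) ω -
        t * U.indicator (fun _ => (1 : ℝ)) ω) ^ 2 ∂μ := integral_nonneg fun ω => sq_nonneg _
    have h1 : ∀ ω, (∑ i, (A i).indicator (fun _ => (1 : ℝ)) ω -
        t * U.indicator (fun _ => (1 : ℝ)) ω) ^ 2 =
        (∑ i, ∑ j, (A i ∩ A j).indicator (fun _ => (1 : ℝ)) ω) -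
        2 * t * (∑ i, (A i).indicator (fun _ => (1 : ℝ)) ω) +
        t * t * U.indicator (fun _ => (1 : ℝ)) ω := by
      intro ω
      have h2 : U.indicator (fun _ => (1 : ℝ)) ω * U.indicator (fun _ => (1 : ℝ)) ω =
          U.indicator (fun _ => (1 : ℝ)) ω := by
        by_cases h : ω ∈ U <;> simp [h]
      have h3 : (∑ i, (A i).indicator (fun _ => (1 : ℝ)) ω) * U.indicator (fun _ => (1 : ℝ)) ω =
          ∑ i, (A i).indicator (fun _ => (1 : ℝ)) ω := by
        rw [Finset.sum_mul]
        refine Finset.sum_congr rfl fun i _ => ?_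
        by_cases h : ω ∈ A i
        · have : ω ∈ U := Set.mem_iUnion.2 ⟨i, h⟩
          simp [h, this]
        · simp [h]
      have h4 : (∑ i, (A i).indicator (fun _ => (1 : ℝ)) ω) *
          (∑ i, (A i).indicator (fun _ => (1 : ℝ)) ω) =
          ∑ i, ∑ j, (A i ∩ A j).indicator (fun _ => (1 : ℝ)) ω := by
        rw [Finset.sum_mul_sum]
        refine Finset.sum_congr rfl fun i _ => Finset.sum_congr rfl fun j _ => ?_
        by_cases h : ω ∈ A i <;> by_cases h' : ω ∈ A j <;> simp [h, h']
      linear_combination h4 + t * t * h2 - 2 * t * h3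
    have h5 : ∫ ω, (∑ i, (A i).indicator (fun _ => (1 : ℝ)) ω -
        t * U.indicator (fun _ => (1 : ℝ)) ω) ^ 2 ∂μ =
        (∑ i, ∑ j, μ.real (A i ∩ A j)) - 2 * t * (∑ i, μ.real (A i)) + t * t * μ.real U := by
      have i1 : Integrable (fun ω => ∑ i, ∑ j, (A i ∩ A j).indicator (fun _ => (1 : ℝ)) ω) μ :=
        integrable_finsetSum _ fun i _ => integrable_finsetSum _ fun j _ => hint _
      have i2 : Integrable (fun ω => 2 * t * (∑ i, (A i).indicator (fun _ => (1 : ℝ)) ω)) μ :=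
        (integrable_finsetSum _ fun i _ => hint _).const_mul _
      have i3 : Integrable (fun ω => (∑ i, ∑ j, (A i ∩ A j).indicator (fun _ => (1 : ℝ)) ω) -
          2 * t * (∑ i, (A i).indicator (fun _ => (1 : ℝ)) ω)) μ := i1.sub i2
      simp_rw [h1]
      rw [integral_add i3 ((hint U).const_mul _), integral_sub i1 i2,
        integral_const_mul, integral_const_mul, integral_finsetSum _ fun i _ => hint _,
        integral_finsetSum _ fun i _ => integrable_finsetSum _ fun j _ => hint _, hI]
      simp_rw [hI]
      congr 2
      refine Finset.sum_congr rfl fun i _ => ?_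
      rw [integral_finsetSum _ fun j _ => hint _]
      simp_rw [hI]
    rw [h5] at h0
    linarith
  have := discrim_le_zero key
  rw [discrim] at this
  nlinarith

/-- The second moment method for events that are pairwise almost uncorrelated. -/
theorem one_le_mul_measureReal_iUnion {Ω ι : Type*} [MeasurableSpace Ω]
    [DiscreteMeasurableSpace Ω] (μ : Measure Ω) [IsProbabilityMeasure μ] [Fintype ι]
    (A : ι → Set Ω) {c : ℝ} (hc : 0 ≤ c)
    (h : ∀ i j, i ≠ j → μ.real (A i ∩ A j) ≤ c * (μ.real (A i) * μ.real (A j)))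
    (hpos : 0 < ∑ i, μ.real (A i)) :
    1 ≤ ((∑ i, μ.real (A i))⁻¹ + c) * μ.real (⋃ i, A i) := by
  classical
  set S := ∑ i, μ.real (A i)
  have h1 : ∑ i, ∑ j, μ.real (A i ∩ A j) ≤ S + c * S ^ 2 := by
    calc ∑ i, ∑ j, μ.real (A i ∩ A j)
        ≤ ∑ i, ∑ j, ((if i = j then μ.real (A i) else 0) +
            c * (μ.real (A i) * μ.real (A j))) := by
          refine Finset.sum_le_sum fun i _ => Finset.sum_le_sum fun j _ => ?_
          by_cases hij : i = j
          · subst hij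
            simp
            positivity
          · simpa [hij] using h i j hij
      _ = S + c * S ^ 2 := by
          simp only [Finset.sum_add_distrib, Finset.sum_ite_eq, Finset.mem_univ, if_true,
            ← Finset.mul_sum, ← Finset.sum_mul]
          rw [pow_two]
  have h2 := (sq_sum_measureReal_le μ A).trans
    (mul_le_mul_of_nonneg_right h1 measureReal_nonneg)
  change S ^ 2 ≤ _ at h2
  have h3 : S ^ 2 * 1 ≤ S ^ 2 * ((S⁻¹ + c) * μ.real (⋃ i, A i)) := by
    calc S ^ 2 * 1 ≤ (S + c * S ^ 2) * μ.real (⋃ i, A i) := by linarith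
      _ = _ := by field_simp
  exact le_of_mul_le_mul_left h3 (by positivity)

theorem withHighProbability_of_le {p : ℕ → ℝ} {Q : ∀ n : ℕ, SimpleGraph (Fin n) → Prop}
    {b : ℕ → ℝ} (hb : Tendsto b atTop (𝓝 1))
    (h : ∀ᶠ n in atTop, b n ≤ (erdosRenyi n (p n)).real {G | Q n G}) :
    WithHighProbability p Q := by
  have h1 : Tendsto (fun n => (erdosRenyi n (p n)).real {G | Q n G}) atTop (𝓝 1) :=
    tendsto_of_tendsto_of_tendsto_of_le_of_le' hb tendsto_const_nhds h
      (Eventually.of_forall fun n => measureReal_le_one)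
  have h2 := ENNReal.tendsto_ofReal h1
  simpa [WithHighProbability] using h2

theorem withHighProbability_of_not_le {p : ℕ → ℝ} {Q : ∀ n : ℕ, SimpleGraph (Fin n) → Prop}
    {b : ℕ → ℝ} (hb : Tendsto b atTop (𝓝 0))
    (h : ∀ᶠ n in atTop, (erdosRenyi n (p n)).real {G | ¬ Q n G} ≤ b n) :
    WithHighProbability p Q := by
  refine withHighProbability_of_le (b := fun n => 1 - b n) (by simpa using hb.const_sub 1) ?_
  filter_upwards [h] with n hn
  have := probReal_compl_eq_one_sub (μ := erdosRenyi n (p n)) (s := {G | Q n G})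
    MeasurableSet.of_discrete
  have h' : {G : SimpleGraph (Fin n) | Q n G}ᶜ = {G | ¬ Q n G} := rfl
  rw [h'] at this
  linarith

theorem WithHighProbability.mono {p : ℕ → ℝ} {Q R : ∀ n : ℕ, SimpleGraph (Fin n) → Prop}
    (hQ : WithHighProbability p Q) (h : ∀ᶠ n in atTop, ∀ G, Q n G → R n G) :
    WithHighProbability p R :=
  tendsto_of_tendsto_of_tendsto_of_le_of_le' hQ tendsto_const_nhds
    (h.mono fun _ hn => measure_mono hn) (Eventually.of_forall fun _ => prob_le_one)

theorem WithHighProbability.and {p : ℕ → ℝ} {Q R : ∀ n : ℕ, SimpleGraph (Fin n) → Prop}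
    (hQ : WithHighProbability p Q) (hR : WithHighProbability p R) :
    WithHighProbability p fun n G => Q n G ∧ R n G := by
  have h1 := (ENNReal.tendsto_toReal ENNReal.one_ne_top).comp hQ
  have h2 := (ENNReal.tendsto_toReal ENNReal.one_ne_top).comp hR
  refine withHighProbability_of_not_le (b := fun n =>
    (1 - (erdosRenyi n (p n)).real {G | Q n G}) + (1 - (erdosRenyi n (p n)).real {G | R n G}))
    ?_ (Eventually.of_forall fun n => ?_)
  · simpa [measureReal_def] using (h1.const_sub 1).add (h2.const_sub 1)
  · have := probReal_compl_eq_one_sub (μ := erdosRenyi n (p n)) (s := {G | Q n G})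
      MeasurableSet.of_discrete
    have := probReal_compl_eq_one_sub (μ := erdosRenyi n (p n)) (s := {G | R n G})
      MeasurableSet.of_discrete
    have h : {G : SimpleGraph (Fin n) | ¬ (Q n G ∧ R n G)} = {G | Q n G}ᶜ ∪ {G | R n G}ᶜ := by
      rw [← Set.compl_inter]
      rfl
    rw [h]
    linarith [measureReal_union_le (μ := erdosRenyi n (p n)) {G | Q n G}ᶜ {G | R n G}ᶜ]

end RandomGraph

/-! ### Maximal independent sets of a prescribed size -/

section PrescribedSize

open MeasureTheory

/-- The pairs of distinct elements of a finite set. -/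
def Finset.pairs {V : Type*} [DecidableEq V] (S : Finset V) : Finset (Sym2 V) :=
  S.offDiag.image Sym2.mk.uncurry

theorem Finset.mk_mem_pairs {V : Type*} [DecidableEq V] {S : Finset V} {a b : V} :
    s(a, b) ∈ S.pairs ↔ a ∈ S ∧ b ∈ S ∧ a ≠ b := by
  simp only [Finset.pairs, Finset.mem_image, Finset.mem_offDiag, Prod.exists,
    Function.uncurry_apply_pair, Sym2.eq_iff]
  constructor
  · rintro ⟨x, y, ⟨hx, hy, hxy⟩, ⟨rfl, rfl⟩ | ⟨rfl, rfl⟩⟩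
    · exact ⟨hx, hy, hxy⟩
    · exact ⟨hy, hx, hxy.symm⟩
  · exact fun h => ⟨a, b, h, Or.inl ⟨rfl, rfl⟩⟩

theorem Finset.card_pairs {V : Type*} [DecidableEq V] (S : Finset V) :
    S.pairs.card = S.card.choose 2 :=
  Sym2.card_image_offDiag S

theorem Finset.pairs_inter {V : Type*} [DecidableEq V] (S T : Finset V) :
    S.pairs ∩ T.pairs = (S ∩ T).pairs := by
  ext e
  induction e using Sym2.ind with
  | _ a b =>
    simp only [Finset.mem_inter, Finset.mk_mem_pairs]
    tauto

theorem Finset.not_isDiag_of_mem_pairs {V : Type*} [DecidableEq V] {S : Finset V} {e : Sym2 V}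
    (he : e ∈ S.pairs) : ¬ e.IsDiag := by
  induction e using Sym2.ind with
  | _ a b => exact (Finset.mk_mem_pairs.1 he).2.2

theorem SimpleGraph.forall_mem_pairs_iff {V : Type*} [DecidableEq V] (G : SimpleGraph V)
    (S : Finset V) :
    (∀ e ∈ S.pairs, e ∉ G.edgeSet) ↔ ∀ a ∈ S, ∀ b ∈ S, ¬ G.Adj a b := by
  constructor
  · intro h a ha b hb hab
    exact h s(a, b) (Finset.mk_mem_pairs.2 ⟨ha, hb, hab.ne⟩) hab
  · intro h e he
    induction e using Sym2.ind with
    | _ a b =>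
      have := Finset.mk_mem_pairs.1 he
      exact h a this.1 b this.2.1

theorem erdosRenyi_real_not_mem_edgeSet (n : ℕ) {q : ℝ} (hq0 : 0 ≤ q) (hq1 : q ≤ 1)
    (F : Finset (Sym2 (Fin n))) (hF : ∀ e ∈ F, ¬ e.IsDiag) :
    (erdosRenyi n (1 - q)).real {G | ∀ e ∈ F, e ∉ G.edgeSet} = q ^ F.card := by
  have h := erdosRenyi_real_setOf n (p := 1 - q) (by linarith) (by linarith) ∅ F (by simp) hF
    (by simp)
  simpa using h

theorem erdosRenyi_real_isIndep (n : ℕ) {q : ℝ} (hq0 : 0 ≤ q) (hq1 : q ≤ 1)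
    (S : Finset (Fin n)) :
    (erdosRenyi n (1 - q)).real {G | ∀ a ∈ S, ∀ b ∈ S, ¬ G.Adj a b} =
      q ^ S.card.choose 2 := by
  simp_rw [← SimpleGraph.forall_mem_pairs_iff]
  rw [erdosRenyi_real_not_mem_edgeSet n hq0 hq1 _ fun e => Finset.not_isDiag_of_mem_pairs,
    Finset.card_pairs]

theorem erdosRenyi_real_isIndep_inter_mul (n : ℕ) {q : ℝ} (hq0 : 0 ≤ q) (hq1 : q ≤ 1)
    (S T : Finset (Fin n)) :
    (erdosRenyi n (1 - q)).real ({G | ∀ a ∈ S, ∀ b ∈ S, ¬ G.Adj a b} ∩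
      {G | ∀ a ∈ T, ∀ b ∈ T, ¬ G.Adj a b}) * q ^ (S ∩ T).card.choose 2 =
      q ^ S.card.choose 2 * q ^ T.card.choose 2 := by
  have h : ({G | ∀ a ∈ S, ∀ b ∈ S, ¬ G.Adj a b} ∩ {G | ∀ a ∈ T, ∀ b ∈ T, ¬ G.Adj a b} :
      Set (SimpleGraph (Fin n))) = {G | ∀ e ∈ S.pairs ∪ T.pairs, e ∉ G.edgeSet} := by
    ext G
    simp only [Set.mem_inter_iff, Set.mem_ofPred_eq, ← SimpleGraph.forall_mem_pairs_iff,
      Finset.mem_union]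
    exact ⟨fun h e he => he.elim (h.1 e) (h.2 e),
      fun h => ⟨fun e he => h e (Or.inl he), fun e he => h e (Or.inr he)⟩⟩
  rw [h, erdosRenyi_real_not_mem_edgeSet n hq0 hq1 _ fun e he => (Finset.mem_union.1 he).elim
    Finset.not_isDiag_of_mem_pairs Finset.not_isDiag_of_mem_pairs, ← pow_add, ← pow_add,
    ← Finset.card_pairs, ← Finset.pairs_inter, Finset.card_union_add_card_inter,
    Finset.card_pairs, Finset.card_pairs]

/-- An independent set fails to be maximal only if it can be enlarged by one of at most `n`
vertices. -/
theorem le_erdosRenyi_real_isMaxIndep (n : ℕ) {q : ℝ} (hq0 : 0 ≤ q) (hq1 : q ≤ 1)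
    (S : Finset (Fin n)) :
    q ^ S.card.choose 2 * (1 - n * q ^ S.card) ≤
      (erdosRenyi n (1 - q)).real {G | G.IsMaxIndep S} := by
  classical
  set μ := erdosRenyi n (1 - q)
  have hsub : {G : SimpleGraph (Fin n) | ∀ a ∈ S, ∀ b ∈ S, ¬ G.Adj a b} ⊆
      {G | G.IsMaxIndep S} ∪ ⋃ v ∈ Sᶜ, {G | ∀ a ∈ insert v S, ∀ b ∈ insert v S, ¬ G.Adj a b} := by
    intro G hG
    by_cases h : G.IsMaxIndep S
    · exact Or.inl h
    · refine Or.inr ?_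
      have h' : ¬ ∀ v, v ∉ S → ∃ a ∈ S, G.Adj v a := fun h' => h ⟨hG, h'⟩
      push Not at h'
      obtain ⟨v, hv, hva⟩ := h'
      refine Set.mem_iUnion₂.2 ⟨v, Finset.mem_compl.2 hv, fun a ha b hb hab => ?_⟩
      rw [Finset.mem_insert] at ha hb
      rcases ha with rfl | ha <;> rcases hb with rfl | hb
      · exact hab.ne rfl
      · exact hva b hb hab
      · exact hva a ha hab.symm
      · exact hG a ha b hb hab
  have h1 := (measureReal_mono (μ := μ) hsub).trans (measureReal_union_le _ _)
  have h2 : μ.real (⋃ v ∈ Sᶜ, {G | ∀ a ∈ insert v S, ∀ b ∈ insert v S, ¬ G.Adj a b}) ≤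
      n * (q ^ S.card.choose 2 * q ^ S.card) := by
    refine (measureReal_biUnion_finset_le _ _).trans ?_
    calc ∑ v ∈ Sᶜ, μ.real {G | ∀ a ∈ insert v S, ∀ b ∈ insert v S, ¬ G.Adj a b}
        = ∑ v ∈ Sᶜ, (q ^ S.card.choose 2 * q ^ S.card) := by
          refine Finset.sum_congr rfl fun v hv => ?_
          rw [erdosRenyi_real_isIndep n hq0 hq1,
            Finset.card_insert_of_notMem (Finset.mem_compl.1 hv), ← pow_add]
          congr 1
          rw [Nat.choose_succ_succ' _ 1, Nat.choose_one_right, add_comm]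
      _ = (Sᶜ.card : ℝ) * (q ^ S.card.choose 2 * q ^ S.card) := by simp
      _ ≤ n * (q ^ S.card.choose 2 * q ^ S.card) := by
          have : Sᶜ.card ≤ n := by simpa using Sᶜ.card_le_univ
          gcongr
  rw [erdosRenyi_real_isIndep n hq0 hq1] at h1
  linarith

/-- The generating function of the number of agreements of a function with all others. -/
theorem sum_pow_card_agree {k m : ℕ} (Q : ℝ) (f : Fin k → Fin m) :
    ∑ g : Fin k → Fin m, Q ^ (Finset.univ.filter fun i => f i = g i).card =
      (Q + (m - 1)) ^ k := by
  have h1 : ∀ g : Fin k → Fin m, Q ^ (Finset.univ.filter fun i => f i = g i).card =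
      ∏ i, if f i = g i then Q else 1 := by
    intro g
    rw [Finset.prod_ite]
    simp
  simp_rw [h1]
  rw [← Fintype.piFinset_univ, ← Finset.prod_univ_sum (fun _ => Finset.univ)
    (fun i x => if f i = x then Q else (1 : ℝ))]
  have h2 : ∀ i, ∑ x : Fin m, (if f i = x then Q else (1 : ℝ)) = Q + (m - 1) := by
    intro i
    have h3 : ∀ x : Fin m, (if f i = x then Q else (1 : ℝ)) =
        (if f i = x then Q - 1 else 0) + 1 := by
      intro x
      split_ifs <;> ring
    simp_rw [h3, Finset.sum_add_distrib]
    simp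
    ring
  simp [h2]

theorem one_le_pow_mul_pow_choose {q Q : ℝ} {k l : ℕ} (hq0 : 0 < q) (hq1 : q ≤ 1) (hQ0 : 0 ≤ Q)
    (hQ : 1 ≤ Q ^ 2 * q ^ (k - 1)) (hl : l ≤ k) : 1 ≤ Q ^ l * q ^ l.choose 2 := by
  have h1 : (Q ^ l * q ^ l.choose 2) ^ 2 = (Q ^ 2 * q ^ (l - 1)) ^ l := by
    have h2 : l.choose 2 * 2 = (l - 1) * l := by
      rw [Nat.choose_two_right, mul_comm (l - 1) l]
      exact Nat.div_mul_cancel (Nat.even_mul_pred_self l).two_dvd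
    rw [mul_pow, mul_pow, ← pow_mul, ← pow_mul, ← pow_mul, ← pow_mul, h2, mul_comm l 2]
  have h3 : 1 ≤ Q ^ 2 * q ^ (l - 1) :=
    hQ.trans (mul_le_mul_of_nonneg_left (pow_le_pow_of_le_one hq0.le hq1 (by omega))
      (sq_nonneg Q))
  have h4 : 1 ≤ (Q ^ l * q ^ l.choose 2) ^ 2 := h1 ▸ one_le_pow₀ h3
  exact (one_le_sq_iff₀ (by positivity)).1 h4

/-- The second moment method for the independent sets that are transversals of `k` disjoint blocks
of `m` vertices. The number of agreements of two uniformly random transversals is a sum of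
independent indicators, so that the second moment can be summed exactly once
`q ^ (-(l choose 2))` is replaced by `Q ^ l`. -/
theorem le_mul_erdosRenyi_real_exists_isMaxIndep {n k m : ℕ} (hm : 0 < m) (hkm : k * m ≤ n)
    {q Q : ℝ} (hq0 : 0 < q) (hq1 : q ≤ 1) (hQ0 : 0 ≤ Q) (hQ : 1 ≤ Q ^ 2 * q ^ (k - 1))
    (hnq : n * q ^ k ≤ 1) :
    (1 - n * q ^ k) ^ 2 ≤ Real.exp (k * Q / m) *
      (erdosRenyi n (1 - q)).real {G | ∃ S : Finset (Fin n), G.IsMaxIndep S ∧ S.card = k} := by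
  classical
  set μ := erdosRenyi n (1 - q)
  let ι : Fin k × Fin m → Fin n := fun x => Fin.castLE hkm (finProdFinEquiv x)
  have hι : Function.Injective ι :=
    (Fin.castLE_injective hkm).comp finProdFinEquiv.injective
  let S : (Fin k → Fin m) → Finset (Fin n) := fun f => Finset.univ.image fun i => ι (i, f i)
  have hScard : ∀ f, (S f).card = k := by
    intro f
    rw [Finset.card_image_of_injective _ fun i j hij => (Prod.ext_iff.1 (hι hij)).1]
    simp
  have hSinter : ∀ f g, (S f ∩ S g).card = (Finset.univ.filter fun i => f i = g i).card := by
    intro f g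
    rw [← Finset.card_image_of_injective (f := fun i => ι (i, f i))
      (Finset.univ.filter fun i => f i = g i) fun i j hij => (Prod.ext_iff.1 (hι hij)).1]
    congr 1
    ext v
    simp only [S, Finset.mem_inter, Finset.mem_image, Finset.mem_univ, true_and,
      Finset.mem_filter]
    constructor
    · rintro ⟨⟨i, rfl⟩, ⟨j, hj⟩⟩
      have h := Prod.ext_iff.1 (hι hj)
      obtain rfl : j = i := h.1
      exact ⟨j, h.2.symm, rfl⟩
    · rintro ⟨i, hi, rfl⟩
      exact ⟨⟨i, rfl⟩, ⟨i, by rw [hi]⟩⟩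
  set B : (Fin k → Fin m) → Set (SimpleGraph (Fin n)) := fun f =>
    {G | ∀ a ∈ S f, ∀ b ∈ S f, ¬ G.Adj a b}
  set A : (Fin k → Fin m) → Set (SimpleGraph (Fin n)) := fun f => {G | G.IsMaxIndep (S f)}
  have hAB : ∀ f, A f ⊆ B f := fun f G hG => hG.not_adj
  set C := q ^ k.choose 2
  have hC : 0 < C := by positivity
  have hM : (0 : ℝ) < m := by exact_mod_cast hm
  have hlow : (m : ℝ) ^ k * (C * (1 - n * q ^ k)) ≤ ∑ f, μ.real (A f) := by
    calc (m : ℝ) ^ k * (C * (1 - n * q ^ k))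
        = ∑ f : Fin k → Fin m, C * (1 - n * q ^ k) := by simp
      _ ≤ _ := Finset.sum_le_sum fun f _ => by
          have := le_erdosRenyi_real_isMaxIndep n hq0.le hq1 (S f)
          rwa [hScard f] at this
  have hupp : ∑ f, ∑ g, μ.real (A f ∩ A g) ≤
      (m : ℝ) ^ k * (C * C * (m ^ k * Real.exp (k * Q / m))) := by
    have h1 : ∀ f g, μ.real (A f ∩ A g) ≤
        C * C * Q ^ (Finset.univ.filter fun i => f i = g i).card := by
      intro f g
      have h2 := erdosRenyi_real_isIndep_inter_mul n hq0.le hq1 (S f) (S g)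
      rw [hSinter, hScard, hScard] at h2
      have hl : (Finset.univ.filter fun i => f i = g i).card ≤ k := by
        simpa using Finset.card_le_univ (Finset.univ.filter fun i => f i = g i)
      have h3 := one_le_pow_mul_pow_choose hq0 hq1 hQ0 hQ hl
      set l := (Finset.univ.filter fun i => f i = g i).card
      calc μ.real (A f ∩ A g) ≤ μ.real (B f ∩ B g) :=
            measureReal_mono (Set.inter_subset_inter (hAB f) (hAB g))
        _ ≤ μ.real (B f ∩ B g) * (Q ^ l * q ^ l.choose 2) :=
            le_mul_of_one_le_right measureReal_nonneg h3
        _ = (μ.real (B f ∩ B g) * q ^ l.choose 2) * Q ^ l := by ring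
        _ = C * C * Q ^ l := by rw [h2]
    have h4 : (Q + (m - 1)) ^ k ≤ m ^ k * Real.exp (k * Q / m) := by
      have h5 : Q + (m - 1) ≤ m * Real.exp (Q / m) := by
        have h6 := mul_le_mul_of_nonneg_left (Real.add_one_le_exp (Q / m)) hM.le
        rw [mul_add, mul_div_cancel₀ _ hM.ne'] at h6
        linarith
      have h7 : 0 ≤ Q + ((m : ℝ) - 1) := by
        have : (1 : ℝ) ≤ m := by exact_mod_cast hm
        linarith
      calc (Q + (m - 1)) ^ k ≤ (m * Real.exp (Q / m)) ^ k := pow_le_pow_left₀ h7 h5 k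
        _ = m ^ k * Real.exp (k * Q / m) := by
            rw [mul_pow, ← Real.exp_nat_mul, mul_div_assoc]
    calc ∑ f, ∑ g, μ.real (A f ∩ A g)
        ≤ ∑ f, ∑ g, C * C * Q ^ (Finset.univ.filter fun i => f i = g i).card :=
          Finset.sum_le_sum fun f _ => Finset.sum_le_sum fun g _ => h1 f g
      _ = (m : ℝ) ^ k * (C * C * (Q + (m - 1)) ^ k) := by
          simp_rw [← Finset.mul_sum, sum_pow_card_agree]
          simp
          ring
      _ ≤ _ := by gcongr
  have hU : μ.real (⋃ f, A f) ≤
      μ.real {G | ∃ S : Finset (Fin n), G.IsMaxIndep S ∧ S.card = k} := by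
    refine measureReal_mono (Set.iUnion_subset fun f G hG => ?_)
    exact ⟨S f, hG, hScard f⟩
  have h0 : 0 ≤ (m : ℝ) ^ k * (C * (1 - n * q ^ k)) := by
    have : 0 ≤ 1 - n * q ^ k := by linarith
    positivity
  have hfin := (pow_le_pow_left₀ h0 hlow 2).trans ((sq_sum_measureReal_le μ A).trans
    (mul_le_mul hupp hU measureReal_nonneg (by positivity)))
  have hpos : 0 < ((m : ℝ) ^ k * C) ^ 2 := by positivity
  refine le_of_mul_le_mul_left ?_ hpos
  linarith

/-- The sequence `Q` is an upper bound for `q ^ (-(k - 1) / 2)`. The first limit says that almost all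
independent `k`-sets are maximal, the second one that two random `k`-sets overlap too little for
the events that they are independent to be correlated. -/
theorem withHighProbability_exists_isMaxIndep {k : ℕ → ℕ} {q Q : ℕ → ℝ}
    (hk : ∀ᶠ n in atTop, 1 ≤ k n) (hq : ∀ᶠ n in atTop, 0 < q n ∧ q n ≤ 1)
    (hQ : ∀ᶠ n in atTop, 0 ≤ Q n ∧ 1 ≤ Q n ^ 2 * q n ^ (k n - 1))
    (h1 : Tendsto (fun n : ℕ => n * q n ^ k n) atTop (𝓝 0))
    (h2 : Tendsto (fun n : ℕ => (k n : ℝ) ^ 2 * Q n / n) atTop (𝓝 0)) :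
    WithHighProbability (fun n => 1 - q n)
      fun n G => ∃ S : Finset (Fin n), G.IsMaxIndep S ∧ S.card = k n := by
  refine withHighProbability_of_le (b := fun n : ℕ =>
    (1 - n * q n ^ k n) ^ 2 * Real.exp (-(2 * ((k n : ℝ) ^ 2 * Q n / n)))) ?_ ?_
  · have h3 := ((h1.const_sub 1).pow 2).mul
      ((Real.continuous_exp.tendsto _).comp (h2.const_mul 2).neg)
    simpa using h3
  · filter_upwards [hk, hq, hQ, h1.eventually_le_const zero_lt_one,
      h2.eventually_le_const zero_lt_one, eventually_ge_atTop 1] with n hk hq hQ h1 h2 hn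
    have hn0 : (0 : ℝ) < n := by exact_mod_cast hn
    have hQ1 : 1 ≤ Q n := by
      have h : 1 ≤ Q n ^ 2 :=
        hQ.2.trans (mul_le_of_le_one_right (sq_nonneg _) (pow_le_one₀ hq.1.le hq.2))
      exact (one_le_sq_iff₀ hQ.1).1 h
    have hkn : k n ≤ n := by
      rw [div_le_one hn0] at h2
      have h3 : (1 : ℝ) ≤ k n := by exact_mod_cast hk
      have h4 : (k n : ℝ) ≤ n := by nlinarith [mul_nonneg (sq_nonneg (k n : ℝ)) (sub_nonneg.2 hQ1)]
      exact_mod_cast h4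
    have hm : 0 < n / k n := Nat.div_pos hkn hk
    have h3 := le_mul_erdosRenyi_real_exists_isMaxIndep hm (Nat.mul_div_le n (k n)) hq.1 hq.2
      hQ.1 hQ.2 h1
    set P := (erdosRenyi n (1 - q n)).real {G | ∃ S : Finset (Fin n), G.IsMaxIndep S ∧ S.card = k n}
    have h4 : (k n : ℝ) * Q n / (n / k n : ℕ) ≤ 2 * ((k n : ℝ) ^ 2 * Q n / n) := by
      have h5 : (n : ℝ) ≤ 2 * k n * (n / k n : ℕ) := by
        have h6 : n < k n * (n / k n) + k n := by
          have := Nat.div_add_mod n (k n)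
          have := Nat.mod_lt n hk
          omega
        have h7 : k n ≤ k n * (n / k n) := Nat.le_mul_of_pos_right _ hm
        have h8 : n ≤ 2 * k n * (n / k n) := by nlinarith
        exact_mod_cast h8
      have hm' : (0 : ℝ) < (n / k n : ℕ) := by exact_mod_cast hm
      rw [← mul_div_assoc, div_le_div_iff₀ hm' hn0]
      have h9 : 0 ≤ (k n : ℝ) * Q n := mul_nonneg (Nat.cast_nonneg _) hQ.1
      nlinarith
    calc (1 - n * q n ^ k n) ^ 2 * Real.exp (-(2 * ((k n : ℝ) ^ 2 * Q n / n)))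
        ≤ (Real.exp (2 * ((k n : ℝ) ^ 2 * Q n / n)) * P) *
            Real.exp (-(2 * ((k n : ℝ) ^ 2 * Q n / n))) := by
          gcongr
          refine h3.trans ?_
          gcongr
      _ = P := by
          rw [Real.exp_neg]
          field_simp

end PrescribedSize

/-! ### Isolated paths and dominating vertices -/

section IsolatedPath

open MeasureTheory

/-- Isolated paths are components: if they share a vertex in the same role then they agree. -/
theorem SimpleGraph.IsIsolatedPath.center_eq {V : Type*} {G : SimpleGraph V} {c a b c' a' b' : V}
    (h : G.IsIsolatedPath c a b) (h' : G.IsIsolatedPath c' a' b')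
    (hv : c = c' ∨ a = a' ∨ b = b') : c = c' := by
  rcases hv with rfl | rfl | rfl
  · rfl
  · exact (h'.adj_left c).1 ((h.adj_left c).2 rfl)
  · exact (h'.adj_right c).1 ((h.adj_right c).2 rfl)

variable {V : Type*} [DecidableEq V]

/-- The two edges of the path `a - c - b`. -/
def Sym2.pathEdges (c a b : V) : Finset (Sym2 V) := {s(c, a), s(c, b)}

/-- The pairs that meet the path `a - c - b` without being edges of it. -/
def Sym2.pathNonEdges [Fintype V] (c a b : V) : Finset (Sym2 V) :=
  Finset.univ.filter fun e => ¬ e.IsDiag ∧ (∃ v ∈ ({c, a, b} : Finset V), v ∈ e) ∧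
    e ∉ pathEdges c a b

theorem Sym2.mem_pathNonEdges [Fintype V] {c a b : V} {e : Sym2 V} :
    e ∈ pathNonEdges c a b ↔ ¬ e.IsDiag ∧ (∃ v ∈ ({c, a, b} : Finset V), v ∈ e) ∧
      e ∉ pathEdges c a b := by
  simp only [pathNonEdges, Finset.mem_filter, Finset.mem_univ, true_and]

theorem Sym2.subset_of_mem_pathEdges {c a b : V} {e : Sym2 V} (he : e ∈ pathEdges c a b) :
    ∀ v ∈ e, v ∈ ({c, a, b} : Finset V) := by
  simp only [pathEdges, Finset.mem_insert, Finset.mem_singleton] at he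
  rcases he with rfl | rfl <;> simp

theorem Sym2.card_pathEdges {c a b : V} (hab : a ≠ b) : (pathEdges c a b).card = 2 :=
  Finset.card_pair fun h => hab (Sym2.congr_right.1 h)

theorem SimpleGraph.isIsolatedPath_iff [Fintype V] (G : SimpleGraph V) {c a b : V} (hca : c ≠ a)
    (hcb : c ≠ b) (hab : a ≠ b) :
    G.IsIsolatedPath c a b ↔ (∀ e ∈ Sym2.pathEdges c a b, e ∈ G.edgeSet) ∧
      ∀ e ∈ Sym2.pathNonEdges c a b, e ∉ G.edgeSet := by
  constructor
  · intro h
    constructor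
    · intro e he
      simp only [Sym2.pathEdges, Finset.mem_insert, Finset.mem_singleton] at he
      rcases he with rfl | rfl
      · exact (h.adj_center a).2 (Or.inl rfl)
      · exact (h.adj_center b).2 (Or.inr rfl)
    · intro e he heG
      obtain ⟨-, ⟨v, hv, hve⟩, hne⟩ := (Sym2.mem_pathNonEdges.1 he)
      obtain ⟨w, rfl⟩ := Sym2.mem_iff_exists.1 hve
      have hvw : G.Adj v w := heG
      apply hne
      simp only [Finset.mem_insert, Finset.mem_singleton] at hv
      simp only [Sym2.pathEdges, Finset.mem_insert, Finset.mem_singleton]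
      rcases hv with rfl | rfl | rfl
      · rcases (h.adj_center w).1 hvw with rfl | rfl
        · exact Or.inl rfl
        · exact Or.inr rfl
      · rw [(h.adj_left w).1 hvw]
        exact Or.inl Sym2.eq_swap
      · rw [(h.adj_right w).1 hvw]
        exact Or.inr Sym2.eq_swap
  · rintro ⟨hE, hF⟩
    have h1 : G.Adj c a := hE s(c, a) (by simp [Sym2.pathEdges])
    have h2 : G.Adj c b := hE s(c, b) (by simp [Sym2.pathEdges])
    have h3 : ∀ v ∈ ({c, a, b} : Finset V), ∀ w, G.Adj v w → s(v, w) ∈ Sym2.pathEdges c a b := by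
      intro v hv w hvw
      by_contra hne
      exact hF s(v, w) (Sym2.mem_pathNonEdges.2 ⟨hvw.ne, ⟨v, hv, by simp⟩, hne⟩) hvw
    simp only [Sym2.pathEdges, Finset.mem_insert, Finset.mem_singleton, Sym2.eq_iff] at h3
    refine ⟨fun v => ⟨fun h => ?_, ?_⟩, fun v => ⟨fun h => ?_, ?_⟩, fun v => ⟨fun h => ?_, ?_⟩⟩
    · have := h3 c (by simp) v h
      tauto
    · rintro (rfl | rfl)
      exacts [h1, h2]
    · have := h3 a (by simp) v h
      tauto
    · rintro rfl
      exact h1.symm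
    · have := h3 b (by simp) v h
      have := hab.symm
      tauto
    · rintro rfl
      exact h2.symm

theorem Sym2.card_pathNonEdges_le {n : ℕ} (c a b : Fin n) :
    (pathNonEdges c a b).card ≤ 3 * n := by
  have hsub : pathNonEdges c a b ⊆
      (({c, a, b} : Finset (Fin n)) ×ˢ (Finset.univ : Finset (Fin n))).image Sym2.mk.uncurry := by
    intro e he
    obtain ⟨-, ⟨v, hv, hve⟩, -⟩ := (Sym2.mem_pathNonEdges.1 he)
    obtain ⟨w, rfl⟩ := Sym2.mem_iff_exists.1 hve
    exact Finset.mem_image.2 ⟨(v, w), Finset.mem_product.2 ⟨hv, Finset.mem_univ _⟩, rfl⟩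
  refine (Finset.card_le_card hsub).trans (Finset.card_image_le.trans ?_)
  rw [Finset.card_product, Finset.card_univ, Fintype.card_fin]
  exact Nat.mul_le_mul_right _ Finset.card_le_three

/-- A pair that meets two disjoint paths consists of a vertex of each. -/
theorem Sym2.card_pathNonEdges_inter_le [Fintype V] {c a b c' a' b' : V}
    (hdisj : Disjoint ({c, a, b} : Finset V) {c', a', b'}) :
    (pathNonEdges c a b ∩ pathNonEdges c' a' b').card ≤ 9 := by
  have hsub : pathNonEdges c a b ∩ pathNonEdges c' a' b' ⊆
      (({c, a, b} : Finset V) ×ˢ ({c', a', b'} : Finset V)).image Sym2.mk.uncurry := by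
    intro e he
    rw [Finset.mem_inter] at he
    obtain ⟨-, ⟨v, hv, hve⟩, -⟩ := (Finset.mem_filter.1 he.1).2
    obtain ⟨-, ⟨w, hw, hwe⟩, -⟩ := (Finset.mem_filter.1 he.2).2
    have hvw : v ≠ w := fun h => Finset.disjoint_left.1 hdisj hv (h ▸ hw)
    exact Finset.mem_image.2 ⟨(v, w), Finset.mem_product.2 ⟨hv, hw⟩,
      ((Sym2.mem_and_mem_iff hvw).1 ⟨hve, hwe⟩).symm⟩
  refine (Finset.card_le_card hsub).trans (Finset.card_image_le.trans ?_)
  rw [Finset.card_product]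
  exact Nat.mul_le_mul (Finset.card_le_three) (Finset.card_le_three)

theorem erdosRenyi_real_isIsolatedPath (n : ℕ) {p : ℝ} (hp0 : 0 ≤ p) (hp1 : p ≤ 1)
    {c a b : Fin n} (hca : c ≠ a) (hcb : c ≠ b) (hab : a ≠ b) :
    (erdosRenyi n p).real {G | G.IsIsolatedPath c a b} =
      p ^ 2 * (1 - p) ^ (Sym2.pathNonEdges c a b).card := by
  simp_rw [SimpleGraph.isIsolatedPath_iff _ hca hcb hab]
  rw [erdosRenyi_real_setOf n hp0 hp1, Sym2.card_pathEdges hab]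
  · intro e he
    simp only [Sym2.pathEdges, Finset.mem_insert, Finset.mem_singleton] at he
    rcases he with rfl | rfl
    exacts [hca, hcb]
  · exact fun e he => (Sym2.mem_pathNonEdges.1 he).1
  · exact Finset.disjoint_right.2 fun e he => (Sym2.mem_pathNonEdges.1 he).2.2

theorem erdosRenyi_real_isIsolatedPath_inter_le (n : ℕ) {p : ℝ} (hp0 : 0 ≤ p) (hp1 : p < 1)
    {c a b c' a' b' : Fin n} (hca : c ≠ a) (hcb : c ≠ b) (hab : a ≠ b)
    (hca' : c' ≠ a') (hcb' : c' ≠ b') (hab' : a' ≠ b')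
    (hdisj : Disjoint ({c, a, b} : Finset (Fin n)) {c', a', b'}) :
    (erdosRenyi n p).real ({G | G.IsIsolatedPath c a b} ∩ {G | G.IsIsolatedPath c' a' b'}) ≤
      ((1 - p) ^ 9)⁻¹ * ((erdosRenyi n p).real {G | G.IsIsolatedPath c a b} *
        (erdosRenyi n p).real {G | G.IsIsolatedPath c' a' b'}) := by
  have hset : ({G | G.IsIsolatedPath c a b} ∩ {G | G.IsIsolatedPath c' a' b'} :
      Set (SimpleGraph (Fin n))) =
      {G | (∀ e ∈ Sym2.pathEdges c a b ∪ Sym2.pathEdges c' a' b', e ∈ G.edgeSet) ∧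
        ∀ e ∈ Sym2.pathNonEdges c a b ∪ Sym2.pathNonEdges c' a' b', e ∉ G.edgeSet} := by
    ext G
    simp only [Set.mem_inter_iff, Set.mem_ofPred_eq, SimpleGraph.isIsolatedPath_iff G hca hcb hab,
      SimpleGraph.isIsolatedPath_iff G hca' hcb' hab', Finset.forall_mem_union]
    tauto
  have hdiag : ∀ {x y z : Fin n}, x ≠ y → x ≠ z → ∀ e ∈ Sym2.pathEdges x y z, ¬ e.IsDiag := by
    intro x y z hxy hxz e he
    simp only [Sym2.pathEdges, Finset.mem_insert, Finset.mem_singleton] at he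
    rcases he with rfl | rfl
    exacts [hxy, hxz]
  have hEE : Disjoint (Sym2.pathEdges c a b) (Sym2.pathEdges c' a' b') := by
    refine Finset.disjoint_left.2 fun e he he' => ?_
    have hv := e.out_fst_mem
    exact Finset.disjoint_left.1 hdisj (Sym2.subset_of_mem_pathEdges he _ hv)
      (Sym2.subset_of_mem_pathEdges he' _ hv)
  have hEF : Disjoint (Sym2.pathEdges c a b ∪ Sym2.pathEdges c' a' b')
      (Sym2.pathNonEdges c a b ∪ Sym2.pathNonEdges c' a' b') := by
    refine Finset.disjoint_left.2 fun e he he' => ?_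
    rcases Finset.mem_union.1 he with he | he <;> rcases Finset.mem_union.1 he' with he' | he'
    · exact (Sym2.mem_pathNonEdges.1 he').2.2 he
    · obtain ⟨-, ⟨v, hv, hve⟩, -⟩ := (Sym2.mem_pathNonEdges.1 he')
      exact Finset.disjoint_left.1 hdisj (Sym2.subset_of_mem_pathEdges he v hve) hv
    · obtain ⟨-, ⟨v, hv, hve⟩, -⟩ := (Sym2.mem_pathNonEdges.1 he')
      exact Finset.disjoint_left.1 hdisj hv (Sym2.subset_of_mem_pathEdges he v hve)
    · exact (Sym2.mem_pathNonEdges.1 he').2.2 he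
  rw [hset, erdosRenyi_real_setOf n hp0 hp1.le _ _
    (fun e he => (Finset.mem_union.1 he).elim (hdiag hca hcb e) (hdiag hca' hcb' e))
    (fun e he => (Finset.mem_union.1 he).elim (fun h => (Sym2.mem_pathNonEdges.1 h).1)
      fun h => (Sym2.mem_pathNonEdges.1 h).1) hEF,
    erdosRenyi_real_isIsolatedPath n hp0 hp1.le hca hcb hab,
    erdosRenyi_real_isIsolatedPath n hp0 hp1.le hca' hcb' hab', Finset.card_union_of_disjoint hEE,
    Sym2.card_pathEdges hab, Sym2.card_pathEdges hab']
  have hq : 0 < 1 - p := by linarith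
  have hF := Finset.card_union_add_card_inter (Sym2.pathNonEdges c a b)
    (Sym2.pathNonEdges c' a' b')
  have h9 := Sym2.card_pathNonEdges_inter_le hdisj
  have hle : (1 - p) ^ (9 + (Sym2.pathNonEdges c a b ∪ Sym2.pathNonEdges c' a' b').card) ≤
      (1 - p) ^ ((Sym2.pathNonEdges c a b).card + (Sym2.pathNonEdges c' a' b').card) :=
    pow_le_pow_of_le_one hq.le (by linarith) (by omega)
  rw [pow_add, pow_add] at hle
  rw [inv_mul_eq_div, le_div_iff₀ (by positivity)]
  have hp4 : 0 ≤ p ^ (2 + 2) := by positivity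
  have := mul_le_mul_of_nonneg_left hle hp4
  calc _ = p ^ (2 + 2) * ((1 - p) ^ 9 *
        (1 - p) ^ (Sym2.pathNonEdges c a b ∪ Sym2.pathNonEdges c' a' b').card) := by ring
    _ ≤ _ := this
    _ = _ := by ring

/-- The second moment method for isolated paths with one vertex in each of three blocks of `m`
vertices. Two such paths that share a vertex are equal, and for disjoint ones the correlation comes
only from the nine pairs between them. -/
theorem one_le_mul_erdosRenyi_real_exists_isIsolatedPath {n m : ℕ} (hm : 0 < m) (hmn : 3 * m ≤ n)
    {p : ℝ} (hp0 : 0 < p) (hp1 : p < 1) :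
    1 ≤ ((m ^ 3 * (p ^ 2 * (1 - p) ^ (3 * n)))⁻¹ + ((1 - p) ^ 9)⁻¹) *
      (erdosRenyi n p).real {G | ∃ c a b, a ≠ b ∧ G.IsIsolatedPath c a b} := by
  classical
  set μ := erdosRenyi n p
  have hq : 0 < 1 - p := by linarith
  let ι : Fin 3 × Fin m → Fin n := fun x => Fin.castLE hmn (finProdFinEquiv x)
  have hι : Function.Injective ι :=
    (Fin.castLE_injective hmn).comp finProdFinEquiv.injective
  have hne : ∀ {i j : Fin 3} {x y : Fin m}, i ≠ j → ι (i, x) ≠ ι (j, y) := fun hij h =>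
    hij (Prod.ext_iff.1 (hι h)).1
  have hinj : ∀ {i : Fin 3} {x y : Fin m}, ι (i, x) = ι (i, y) → x = y := fun h =>
    (Prod.ext_iff.1 (hι h)).2
  let A : Fin m × Fin m × Fin m → Set (SimpleGraph (Fin n)) := fun x =>
    {G | G.IsIsolatedPath (ι (0, x.1)) (ι (1, x.2.1)) (ι (2, x.2.2))}
  have hpair : ∀ x y, x ≠ y →
      μ.real (A x ∩ A y) ≤ ((1 - p) ^ 9)⁻¹ * (μ.real (A x) * μ.real (A y)) := by
    intro x y hxy
    by_cases hdisj : x.1 = y.1 ∨ x.2.1 = y.2.1 ∨ x.2.2 = y.2.2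
    · have hempty : A x ∩ A y = ∅ := by
        refine Set.eq_empty_iff_forall_notMem.2 fun G ⟨hx, hy⟩ => hxy ?_
        change G.IsIsolatedPath _ _ _ at hx hy
        have hc := hx.center_eq hy (by
          rcases hdisj with h | h | h
          · exact Or.inl (by rw [h])
          · exact Or.inr (Or.inl (by rw [h]))
          · exact Or.inr (Or.inr (by rw [h])))
        have ha := (hx.adj_center (ι (1, y.2.1))).1
          (hc ▸ (hy.adj_center (ι (1, y.2.1))).2 (Or.inl rfl))
        have hb := (hx.adj_center (ι (2, y.2.2))).1
          (hc ▸ (hy.adj_center (ι (2, y.2.2))).2 (Or.inr rfl))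
        exact Prod.ext (hinj hc) (Prod.ext
          (hinj (ha.resolve_right (hne (by decide)))).symm
          (hinj (hb.resolve_left (hne (by decide)))).symm)
      rw [hempty, measureReal_empty]
      positivity
    · push Not at hdisj
      refine erdosRenyi_real_isIsolatedPath_inter_le n hp0.le hp1 (hne (by decide))
        (hne (by decide)) (hne (by decide)) (hne (by decide)) (hne (by decide)) (hne (by decide)) ?_
      simp only [Finset.disjoint_insert_left, Finset.disjoint_singleton_left, Finset.mem_insert,
        Finset.mem_singleton, not_or]
      exact ⟨⟨fun h => hdisj.1 (hinj h), hne (by decide), hne (by decide)⟩,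
        ⟨hne (by decide), fun h => hdisj.2.1 (hinj h), hne (by decide)⟩,
        ⟨hne (by decide), hne (by decide), fun h => hdisj.2.2 (hinj h)⟩⟩
  have hlow : m ^ 3 * (p ^ 2 * (1 - p) ^ (3 * n)) ≤ ∑ x, μ.real (A x) := by
    calc (m : ℝ) ^ 3 * (p ^ 2 * (1 - p) ^ (3 * n))
        = ∑ x : Fin m × Fin m × Fin m, p ^ 2 * (1 - p) ^ (3 * n) := by
          simp only [Finset.sum_const, Finset.card_univ, Fintype.card_prod, Fintype.card_fin,
            nsmul_eq_mul, Nat.cast_mul]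
          ring
      _ ≤ _ := Finset.sum_le_sum fun x _ => by
          change _ ≤ μ.real {G | G.IsIsolatedPath _ _ _}
          rw [erdosRenyi_real_isIsolatedPath n hp0.le hp1.le (hne (by decide)) (hne (by decide))
            (hne (by decide))]
          exact mul_le_mul_of_nonneg_left (pow_le_pow_of_le_one hq.le (by linarith)
            (Sym2.card_pathNonEdges_le _ _ _)) (sq_nonneg p)
  have hm' : (0 : ℝ) < m := by exact_mod_cast hm
  have hpos : 0 < m ^ 3 * (p ^ 2 * (1 - p) ^ (3 * n)) := by positivity
  have h1 := one_le_mul_measureReal_iUnion μ A (by positivity) hpair (hpos.trans_le hlow)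
  have hU : μ.real (⋃ x, A x) ≤ μ.real {G | ∃ c a b, a ≠ b ∧ G.IsIsolatedPath c a b} :=
    measureReal_mono (Set.iUnion_subset fun x G hG => ⟨_, _, _, hne (by decide), hG⟩)
  refine h1.trans ?_
  gcongr

/-- The second moment method for vertices adjacent to all others. The correlation of two such events
comes only from the pair of the two vertices. -/
theorem one_le_mul_erdosRenyi_real_exists_dominating {n : ℕ} (hn : 0 < n) {p : ℝ} (hp0 : 0 < p)
    (hp1 : p ≤ 1) :
    1 ≤ ((n * p ^ n)⁻¹ + p⁻¹) *
      (erdosRenyi n p).real {G | ∃ v, ∀ w, w ≠ v → G.Adj v w} := by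
  classical
  set μ := erdosRenyi n p
  let E : Fin n → Finset (Sym2 (Fin n)) := fun v => (Finset.univ.erase v).image fun w => s(v, w)
  let A : Fin n → Set (SimpleGraph (Fin n)) := fun v => {G | ∀ w, w ≠ v → G.Adj v w}
  have hA : ∀ v, A v = {G | ∀ e ∈ E v, e ∈ G.edgeSet} := by
    intro v
    ext G
    simp [A, E]
  have hdiag : ∀ v, ∀ e ∈ E v, ¬ e.IsDiag := by
    intro v e he
    obtain ⟨w, hw, rfl⟩ := Finset.mem_image.1 he
    exact (Finset.ne_of_mem_erase hw).symm
  have hprob : ∀ F : Finset (Sym2 (Fin n)), (∀ e ∈ F, ¬ e.IsDiag) →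
      μ.real {G | ∀ e ∈ F, e ∈ G.edgeSet} = p ^ F.card := by
    intro F hF
    have := erdosRenyi_real_setOf n hp0.le hp1 F ∅ hF (by simp) (by simp)
    simpa using this
  have hcard : ∀ v, (E v).card ≤ n := fun v => by
    refine Finset.card_image_le.trans ?_
    simp
  have hpair : ∀ v w, v ≠ w → μ.real (A v ∩ A w) ≤ p⁻¹ * (μ.real (A v) * μ.real (A w)) := by
    intro v w hvw
    have hinter : A v ∩ A w = {G | ∀ e ∈ E v ∪ E w, e ∈ G.edgeSet} := by
      rw [hA, hA]
      ext G
      simp only [Set.mem_inter_iff, Set.mem_ofPred_eq, Finset.forall_mem_union]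
    rw [hinter, hA, hA, hprob _ fun e he => (Finset.mem_union.1 he).elim (hdiag v e) (hdiag w e),
      hprob _ (hdiag v), hprob _ (hdiag w), inv_mul_eq_div, le_div_iff₀ hp0, ← pow_succ, ← pow_add]
    refine pow_le_pow_of_le_one hp0.le hp1 ?_
    rw [← Finset.card_union_add_card_inter]
    refine Nat.add_le_add_left (Finset.card_le_one.2 ?_) _
    have h : ∀ e ∈ E v ∩ E w, e = s(v, w) := by
      intro e he
      obtain ⟨x, -, rfl⟩ := Finset.mem_image.1 (Finset.mem_inter.1 he).1
      obtain ⟨y, -, hy⟩ := Finset.mem_image.1 (Finset.mem_inter.1 he).2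
      exact (Sym2.mem_and_mem_iff hvw).1 ⟨by simp, hy ▸ by simp⟩
    exact fun e he e' he' => (h e he).trans (h e' he').symm
  have hn' : (0 : ℝ) < n := by exact_mod_cast hn
  have hlow : n * p ^ n ≤ ∑ v, μ.real (A v) := by
    calc (n : ℝ) * p ^ n = ∑ v : Fin n, p ^ n := by simp
      _ ≤ _ := Finset.sum_le_sum fun v _ => by
          rw [hA, hprob _ (hdiag v)]
          exact pow_le_pow_of_le_one hp0.le hp1 (hcard v)
  have hpos : 0 < n * p ^ n := by positivity
  have h1 := one_le_mul_measureReal_iUnion μ A (by positivity) hpair (hpos.trans_le hlow)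
  have hU : μ.real (⋃ v, A v) ≤ μ.real {G | ∃ v, ∀ w, w ≠ v → G.Adj v w} :=
    measureReal_mono (Set.iUnion_subset fun v G hG => ⟨v, hG⟩)
  refine h1.trans ?_
  gcongr

end IsolatedPath

/-! ### The regimes of the edge probability -/

section Regimes

open MeasureTheory

theorem tendsto_natCast_rpow_of_neg {s : ℝ} (hs : s < 0) :
    Tendsto (fun n : ℕ => (n : ℝ) ^ s) atTop (𝓝 0) := by
  have h := (tendsto_rpow_neg_atTop (neg_pos.2 hs)).comp
    (tendsto_natCast_atTop_atTop (R := ℝ))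
  simpa [Function.comp_def] using h

theorem natCast_rpow_neg_mem_Ioc {n : ℕ} (hn : 1 ≤ n) {α : ℝ} (hα : 0 ≤ α) :
    0 < (n : ℝ) ^ (-α) ∧ (n : ℝ) ^ (-α) ≤ 1 := by
  have h : (1 : ℝ) ≤ n := by exact_mod_cast hn
  exact ⟨Real.rpow_pos_of_pos (by linarith) _, Real.rpow_le_one_of_one_le_of_nonpos h (by linarith)⟩

theorem Real.exp_neg_two_mul_le_one_sub {x : ℝ} (h0 : 0 ≤ x) (h1 : x ≤ 1 / 2) :
    Real.exp (-(2 * x)) ≤ 1 - x := by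
  rw [Real.exp_neg, inv_le_comm₀ (Real.exp_pos _) (by linarith)]
  refine le_trans ?_ (Real.add_one_le_exp _)
  rw [inv_le_iff_one_le_mul₀ (by linarith)]
  nlinarith

theorem Real.exp_neg_two_le_one_sub_pow {n : ℕ} {x : ℝ} (h0 : 0 ≤ x) (h1 : x ≤ 1 / 2)
    (hn : n * x ≤ 1) : Real.exp (-2) ≤ (1 - x) ^ n := by
  calc Real.exp (-2) ≤ Real.exp (n * (-(2 * x))) := Real.exp_le_exp.2 (by linarith)
    _ = Real.exp (-(2 * x)) ^ n := Real.exp_nat_mul _ _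
    _ ≤ (1 - x) ^ n :=
        pow_le_pow_left₀ (Real.exp_pos _).le (Real.exp_neg_two_mul_le_one_sub h0 h1) n

variable (K : Type*) [Field K]

/-- With few edges, no two of them share a vertex. -/
theorem withHighProbability_isUnmixed_of_sparse {α : ℝ} (hα : 3 / 2 < α) :
    WithHighProbability (fun n => (n : ℝ) ^ (-α)) (fun _ G => (G.edgeIdeal K).IsUnmixed) := by
  refine withHighProbability_of_not_le (b := fun n : ℕ => (n : ℝ) ^ (3 - 2 * α))
    (tendsto_natCast_rpow_of_neg (by linarith)) ?_
  filter_upwards [eventually_ge_atTop 1] with n hn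
  obtain ⟨hp0, hp1⟩ := natCast_rpow_neg_mem_Ioc hn (by linarith : 0 ≤ α)
  have hn0 : (0 : ℝ) < n := by exact_mod_cast hn
  have hb : (n : ℝ) ^ (3 - 2 * α) = n ^ 3 * ((n : ℝ) ^ (-α)) ^ 2 := by
    rw [← Real.rpow_natCast n 3, ← Real.rpow_mul_natCast hn0.le, ← Real.rpow_add hn0]
    congr 1
    push_cast
    ring
  rw [hb]
  set p := (n : ℝ) ^ (-α)
  let A : Fin n × Fin n × Fin n → Set (SimpleGraph (Fin n)) := fun x =>
    {G | x.1 ≠ x.2.2 ∧ G.Adj x.1 x.2.1 ∧ G.Adj x.2.1 x.2.2}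
  have hsub : {G : SimpleGraph (Fin n) | ¬ (G.edgeIdeal K).IsUnmixed} ⊆
      ⋃ x ∈ (Finset.univ : Finset (Fin n × Fin n × Fin n)), A x := by
    intro G hG
    by_contra h
    refine hG (SimpleGraph.isUnmixed_edgeIdeal_of_adj_trans K fun a b c hab hbc hac => ?_)
    by_contra
    exact h (Set.mem_iUnion₂.2 ⟨(a, b, c), Finset.mem_univ _, hac, hab, hbc⟩)
  have hA : ∀ x, (erdosRenyi n p).real (A x) ≤ p ^ 2 := by
    rintro ⟨a, b, c⟩
    by_cases hne : a ≠ b ∧ b ≠ c ∧ a ≠ c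
    · have hcard : ({s(a, b), s(b, c)} : Finset (Sym2 (Fin n))).card = 2 := by
        refine Finset.card_pair fun h => ?_
        rw [Sym2.eq_iff] at h
        tauto
      have h := erdosRenyi_real_setOf n hp0.le hp1 {s(a, b), s(b, c)} ∅
        (by simp [hne.1, hne.2.1]) (by simp) (by simp)
      rw [hcard] at h
      refine le_trans (measureReal_mono fun G hG => ?_) (h.le.trans (by simp))
      obtain ⟨-, h1, h2⟩ := hG
      refine ⟨fun e he => ?_, by simp⟩
      simp only [Finset.mem_insert, Finset.mem_singleton] at he
      rcases he with rfl | rfl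
      exacts [h1, h2]
    · have h : A (a, b, c) = ∅ :=
        Set.eq_empty_iff_forall_notMem.2 fun G hG => hne ⟨hG.2.1.ne, hG.2.2.ne, hG.1⟩
      rw [h, measureReal_empty]
      positivity
  refine (measureReal_mono hsub (measure_ne_top _ _)).trans ((measureReal_biUnion_finset_le _ _).trans
    ((Finset.sum_le_sum fun x _ => hA x).trans (le_of_eq ?_)))
  simp only [Finset.sum_const, Finset.card_univ, Fintype.card_prod, Fintype.card_fin,
    nsmul_eq_mul, Nat.cast_mul]
  ring

/-- With few non-edges, the graph is complete. -/
theorem withHighProbability_isUnmixed_of_dense {α : ℝ} (hα : 2 < α) :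
    WithHighProbability (fun n => 1 - (n : ℝ) ^ (-α))
      (fun _ G => (G.edgeIdeal K).IsUnmixed) := by
  refine withHighProbability_of_not_le (b := fun n : ℕ => (n : ℝ) ^ (2 - α))
    (tendsto_natCast_rpow_of_neg (by linarith)) ?_
  filter_upwards [eventually_ge_atTop 1] with n hn
  obtain ⟨hq0, hq1⟩ := natCast_rpow_neg_mem_Ioc hn (by linarith : 0 ≤ α)
  have hn0 : (0 : ℝ) < n := by exact_mod_cast hn
  have hb : (n : ℝ) ^ (2 - α) = n ^ 2 * (n : ℝ) ^ (-α) := by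
    rw [← Real.rpow_natCast n 2, ← Real.rpow_add hn0]
    congr 1
  rw [hb]
  set q := (n : ℝ) ^ (-α)
  let A : Fin n × Fin n → Set (SimpleGraph (Fin n)) := fun x => {G | x.1 ≠ x.2 ∧ ¬ G.Adj x.1 x.2}
  have hsub : {G : SimpleGraph (Fin n) | ¬ (G.edgeIdeal K).IsUnmixed} ⊆
      ⋃ x ∈ (Finset.univ : Finset (Fin n × Fin n)), A x := by
    intro G hG
    by_contra h
    refine hG (SimpleGraph.isUnmixed_edgeIdeal_of_adj_trans K fun a b c _ _ hac => ?_)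
    by_contra hadj
    exact h (Set.mem_iUnion₂.2 ⟨(a, c), Finset.mem_univ _, hac, hadj⟩)
  have hA : ∀ x, (erdosRenyi n (1 - q)).real (A x) ≤ q := by
    rintro ⟨a, b⟩
    by_cases hne : a = b
    · have h : A (a, b) = ∅ := Set.eq_empty_iff_forall_notMem.2 fun G hG => hG.1 hne
      rw [h, measureReal_empty]
      exact hq0.le
    · have h := erdosRenyi_real_not_mem_edgeSet n hq0.le hq1 {s(a, b)} (by simpa using hne)
      rw [Finset.card_singleton, pow_one] at h
      refine le_trans (measureReal_mono fun G hG => ?_) h.le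
      intro e he
      rw [Finset.mem_singleton.1 he]
      exact hG.2
  refine (measureReal_mono hsub (measure_ne_top _ _)).trans ((measureReal_biUnion_finset_le _ _).trans
    ((Finset.sum_le_sum fun x _ => hA x).trans (le_of_eq ?_)))
  simp only [Finset.sum_const, Finset.card_univ, Fintype.card_prod, Fintype.card_fin,
    nsmul_eq_mul, Nat.cast_mul]
  ring

/-- In this range there is an isolated path on three vertices. -/
theorem withHighProbability_not_isUnmixed_of_sparse {α : ℝ} (h1 : 1 ≤ α) (h2 : α < 3 / 2) :
    WithHighProbability (fun n => (n : ℝ) ^ (-α))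
      (fun _ G => ¬ (G.edgeIdeal K).IsUnmixed) := by
  have hp : Tendsto (fun n : ℕ => (n : ℝ) ^ (-α)) atTop (𝓝 0) :=
    tendsto_natCast_rpow_of_neg (by linarith)
  refine withHighProbability_of_le (b := fun n : ℕ =>
    (216 * Real.exp 6 * (n : ℝ) ^ (2 * α - 3) + ((1 - (n : ℝ) ^ (-α)) ^ 9)⁻¹)⁻¹) ?_ ?_
  · have h := (((tendsto_natCast_rpow_of_neg (by linarith : 2 * α - 3 < 0)).const_mul
      (216 * Real.exp 6)).add (((hp.const_sub 1).pow 9).inv₀ (by norm_num))).inv₀ (by norm_num)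
    simpa using h
  · filter_upwards [eventually_ge_atTop 3] with n hn
    have hn0 : (0 : ℝ) < n := by exact_mod_cast (by omega : 0 < n)
    have hn3 : (3 : ℝ) ≤ n := by exact_mod_cast hn
    have hp0 := (natCast_rpow_neg_mem_Ioc (by omega : 1 ≤ n) (by linarith : 0 ≤ α)).1
    have hpn : n * (n : ℝ) ^ (-α) ≤ 1 := by
      calc n * (n : ℝ) ^ (-α) = (n : ℝ) ^ (1 - α) := by
            rw [sub_eq_add_neg, Real.rpow_add hn0, Real.rpow_one]
        _ ≤ 1 := Real.rpow_le_one_of_one_le_of_nonpos (by linarith) (by linarith)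
    have hpow : (n : ℝ) ^ (2 * α - 3) = (n ^ 3 * ((n : ℝ) ^ (-α)) ^ 2)⁻¹ := by
      rw [← Real.rpow_natCast n 3, ← Real.rpow_mul_natCast hn0.le, ← Real.rpow_add hn0,
        ← Real.rpow_neg hn0.le]
      congr 1
      push_cast
      ring
    rw [hpow]
    set p := (n : ℝ) ^ (-α)
    have hp2 : p ≤ 1 / 2 := by nlinarith
    have hq : 0 < 1 - p := by linarith
    have hm : 0 < n / 3 := by omega
    have hm6 : (n : ℝ) ≤ 6 * (n / 3 : ℕ) := by exact_mod_cast (by omega : n ≤ 6 * (n / 3))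
    have hmain := one_le_mul_erdosRenyi_real_exists_isIsolatedPath hm (Nat.mul_div_le n 3) hp0
      (by linarith)
    have hexp : Real.exp (-6) ≤ (1 - p) ^ (3 * n) := by
      calc Real.exp (-6) = Real.exp (-2) ^ 3 := by
            rw [← Real.exp_nat_mul]
            norm_num
        _ ≤ ((1 - p) ^ n) ^ 3 := pow_le_pow_left₀ (Real.exp_pos _).le
            (Real.exp_neg_two_le_one_sub_pow hp0.le hp2 hpn) 3
        _ = (1 - p) ^ (3 * n) := by rw [← pow_mul, mul_comm]
    have hX : (((n / 3 : ℕ) : ℝ) ^ 3 * (p ^ 2 * (1 - p) ^ (3 * n)))⁻¹ ≤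
        216 * Real.exp 6 * (n ^ 3 * p ^ 2)⁻¹ := by
      have h3 : 216 * Real.exp 6 * (n ^ 3 * p ^ 2)⁻¹ =
          ((n / 6 : ℝ) ^ 3 * (p ^ 2 * Real.exp (-6)))⁻¹ := by
        rw [Real.exp_neg]
        field_simp
        norm_num
      rw [h3]
      have h4 : (n / 6 : ℝ) ≤ (n / 3 : ℕ) := by linarith
      gcongr
    have hP : (erdosRenyi n p).real {G | ∃ c a b, a ≠ b ∧ G.IsIsolatedPath c a b} ≤
        (erdosRenyi n p).real {G | ¬ (G.edgeIdeal K).IsUnmixed} :=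
      measureReal_mono fun G ⟨c, a, b, hab, h⟩ => h.not_isUnmixed K hab
    rw [inv_le_iff_one_le_mul₀' (by positivity)]
    refine hmain.trans ?_
    gcongr

theorem withHighProbability_not_isUnmixed_of_isMaxIndep {p : ℕ → ℝ} {k l : ℕ → ℕ}
    (hkl : ∀ n, k n ≠ l n)
    (hk : WithHighProbability p fun n G => ∃ S : Finset (Fin n), G.IsMaxIndep S ∧ S.card = k n)
    (hl : WithHighProbability p fun n G => ∃ S : Finset (Fin n), G.IsMaxIndep S ∧ S.card = l n) :
    WithHighProbability p fun _ G => ¬ (G.edgeIdeal K).IsUnmixed := by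
  refine (hk.and hl).mono (Eventually.of_forall fun n G h hG => ?_)
  obtain ⟨⟨S, hS, hSk⟩, ⟨T, hT, hTl⟩⟩ := h
  have := (SimpleGraph.edgeIdeal_isUnmixed_iff K G).1 hG S T hS hT
  exact hkl n (hSk ▸ hTl ▸ this)

/-- For a constant edge probability `1 - q` there are maximal independent sets of two consecutive
sizes close to `(3 / 2) log n / log (1 / q)`. Any factor strictly between `1` and `2` would do: the
greedy algorithm gives the lower end of this range, and the independence number is the upper. -/
theorem withHighProbability_not_isUnmixed_of_const {p : ℝ} (hp0 : 0 < p) (hp1 : p < 1) :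
    WithHighProbability (fun _ => p) (fun _ G => ¬ (G.edgeIdeal K).IsUnmixed) := by
  obtain ⟨q, rfl⟩ : ∃ q, p = 1 - q := ⟨1 - p, by ring⟩
  have hq0 : 0 < q := by linarith
  have hq1 : q < 1 := by linarith
  have hlog : Real.log q < 0 := Real.log_neg hq0 hq1
  set L : ℝ := -(3 / 2) / Real.log q with hL
  have hL0 : 0 < L := div_pos_of_neg_of_neg (by norm_num) hlog
  let k : ℕ → ℕ := fun n => ⌈L * Real.log n⌉₊
  let Q : ℕ → ℝ := fun n => q⁻¹ * (n : ℝ) ^ (3 / 4 : ℝ)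
  have hx : ∀ n : ℕ, 1 ≤ n → q ^ (L * Real.log n) = (n : ℝ) ^ (-(3 / 2) : ℝ) := by
    intro n hn
    have hn0 : (0 : ℝ) < n := by exact_mod_cast hn
    rw [Real.rpow_def_of_pos hq0, Real.rpow_def_of_pos hn0, hL]
    have hne := hlog.ne
    congr 1
    field_simp
  have hupper : ∀ n : ℕ, 1 ≤ n → q ^ k n ≤ (n : ℝ) ^ (-(3 / 2) : ℝ) := by
    intro n hn
    rw [← hx n hn, ← Real.rpow_natCast]
    exact Real.rpow_le_rpow_of_exponent_ge hq0 hq1.le (Nat.le_ceil _)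
  have hceil : ∀ n : ℕ, 1 ≤ n → (k n : ℝ) ≤ L * Real.log n + 1 := by
    intro n hn
    have h : 0 ≤ L * Real.log n :=
      mul_nonneg hL0.le (Real.log_nonneg (by exact_mod_cast hn))
    exact (Nat.ceil_lt_add_one h).le
  have hlower : ∀ n : ℕ, 1 ≤ n → (n : ℝ) ^ (-(3 / 2) : ℝ) * q ≤ q ^ k n := by
    intro n hn
    rw [← hx n hn, ← Real.rpow_natCast, ← Real.rpow_add_one hq0.ne']
    exact Real.rpow_le_rpow_of_exponent_ge hq0 hq1.le (hceil n hn)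
  have hlogsq : Tendsto (fun n : ℕ => (L * Real.log n + 3) ^ 2 * Q n / n) atTop (𝓝 0) := by
    have h1 : Tendsto (fun x : ℝ => Real.log x / x ^ (1 / 8 : ℝ)) atTop (𝓝 0) :=
      (isLittleO_log_rpow_atTop (by norm_num : (0 : ℝ) < 1 / 8)).tendsto_div_nhds_zero
    have h2 : Tendsto (fun n : ℕ => Real.log n / (n : ℝ) ^ (1 / 8 : ℝ)) atTop (𝓝 0) :=
      h1.comp tendsto_natCast_atTop_atTop
    have h3 := (((h2.const_mul L).add ((tendsto_natCast_rpow_of_neg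
      (by norm_num : (-(1 / 8) : ℝ) < 0)).const_mul 3)).pow 2).const_mul q⁻¹
    have h4 : q⁻¹ * (L * 0 + 3 * 0) ^ 2 = 0 := by ring
    rw [h4] at h3
    refine h3.congr' ?_
    filter_upwards [eventually_ge_atTop 1] with n hn
    have hn0 : (0 : ℝ) < n := by exact_mod_cast hn
    have h5 : (n : ℝ) ^ (3 / 4 : ℝ) / n = ((n : ℝ) ^ (-(1 / 8) : ℝ)) ^ 2 := by
      rw [← Real.rpow_sub_one hn0.ne', ← Real.rpow_mul_natCast hn0.le]
      congr 1
      norm_num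
    have h6 : Real.log n / (n : ℝ) ^ (1 / 8 : ℝ) = Real.log n * (n : ℝ) ^ (-(1 / 8) : ℝ) := by
      rw [Real.rpow_neg hn0.le, div_eq_mul_inv]
    calc q⁻¹ * (L * (Real.log n / (n : ℝ) ^ (1 / 8 : ℝ)) + 3 * (n : ℝ) ^ (-(1 / 8) : ℝ)) ^ 2
        = (L * Real.log n + 3) ^ 2 * q⁻¹ * ((n : ℝ) ^ (-(1 / 8) : ℝ)) ^ 2 := by
          rw [h6]
          ring
      _ = (L * Real.log n + 3) ^ 2 * q⁻¹ * ((n : ℝ) ^ (3 / 4 : ℝ) / n) := by rw [h5]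
      _ = (L * Real.log n + 3) ^ 2 * Q n / n := by
          simp only [Q]
          ring
  have key : ∀ j : ℕ, 1 ≤ j → j ≤ 2 → WithHighProbability (fun _ => 1 - q)
      fun n G => ∃ S : Finset (Fin n), G.IsMaxIndep S ∧ S.card = k n + j := by
    intro j hj1 hj2
    refine withHighProbability_exists_isMaxIndep (q := fun _ => q) (Q := Q)
      (Eventually.of_forall fun n => by omega) (Eventually.of_forall fun n => ⟨hq0, hq1.le⟩) ?_ ?_ ?_
    · filter_upwards [eventually_ge_atTop 1] with n hn
      have hn0 : (0 : ℝ) < n := by exact_mod_cast hn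
      refine ⟨by positivity, ?_⟩
      have h1 : ((n : ℝ) ^ (3 / 4 : ℝ)) ^ 2 * (n : ℝ) ^ (-(3 / 2) : ℝ) = 1 := by
        rw [← Real.rpow_mul_natCast hn0.le, ← Real.rpow_add hn0]
        norm_num
      calc 1 = Q n ^ 2 * ((n : ℝ) ^ (-(3 / 2) : ℝ) * q * q) := by
            simp only [Q]
            field_simp
            linarith
        _ ≤ Q n ^ 2 * (q ^ k n * q) := by
            have := hlower n hn
            gcongr
        _ = Q n ^ 2 * q ^ (k n + 1) := by rw [pow_succ q]
        _ ≤ Q n ^ 2 * q ^ (k n + j - 1) := by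
            have := pow_le_pow_of_le_one hq0.le hq1.le (by omega : k n + j - 1 ≤ k n + 1)
            gcongr
    · refine squeeze_zero' (Eventually.of_forall fun n => by positivity) ?_
        (tendsto_natCast_rpow_of_neg (by norm_num : (-(1 / 2) : ℝ) < 0))
      filter_upwards [eventually_ge_atTop 1] with n hn
      have hn0 : (0 : ℝ) < n := by exact_mod_cast hn
      calc (n : ℝ) * q ^ (k n + j) ≤ n * (n : ℝ) ^ (-(3 / 2) : ℝ) := by
            have h1 := pow_le_pow_of_le_one hq0.le hq1.le (by omega : k n ≤ k n + j)
            have h2 := h1.trans (hupper n hn)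
            gcongr
        _ = (n : ℝ) ^ (-(1 / 2) : ℝ) := by
            rw [mul_comm, ← Real.rpow_add_one hn0.ne']
            norm_num
    · refine squeeze_zero' (Eventually.of_forall fun n => by positivity) ?_ hlogsq
      filter_upwards [eventually_ge_atTop 1] with n hn
      have h1 := hceil n hn
      have h2 : ((k n + j : ℕ) : ℝ) ≤ L * Real.log n + 3 := by
        have : (j : ℝ) ≤ 2 := by exact_mod_cast hj2
        push_cast
        linarith
      have hQ0 : 0 ≤ Q n := by positivity
      gcongr
  exact withHighProbability_not_isUnmixed_of_isMaxIndep K (fun n => by simp) (key 1 le_rfl (by simp))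
    (key 2 (by simp) le_rfl)

theorem withHighProbability_exists_isMaxIndep_of_dense {α : ℝ} (hα : 0 < α) {k : ℕ} (hk : 1 ≤ k)
    (h1 : 1 < α * k) (h2 : α * (k - 1) < 2) :
    WithHighProbability (fun n => 1 - (n : ℝ) ^ (-α))
      fun n G => ∃ S : Finset (Fin n), G.IsMaxIndep S ∧ S.card = k := by
  refine withHighProbability_exists_isMaxIndep (k := fun _ => k)
    (q := fun n : ℕ => (n : ℝ) ^ (-α)) (Q := fun n : ℕ => (n : ℝ) ^ (α * (k - 1) / 2))
    (Eventually.of_forall fun _ => hk) ?_ ?_ ?_ ?_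
  · filter_upwards [eventually_ge_atTop 1] with n hn
    exact natCast_rpow_neg_mem_Ioc hn hα.le
  · filter_upwards [eventually_ge_atTop 1] with n hn
    have hn0 : (0 : ℝ) < n := by exact_mod_cast hn
    refine ⟨by positivity, le_of_eq ?_⟩
    rw [← Real.rpow_mul_natCast hn0.le, ← Real.rpow_mul_natCast hn0.le, ← Real.rpow_add hn0,
      Nat.cast_sub hk]
    have h3 : α * (k - 1) / 2 * (2 : ℕ) + -α * ((k : ℝ) - (1 : ℕ)) = 0 := by
      push_cast
      ring
    rw [h3, Real.rpow_zero]
  · refine (tendsto_natCast_rpow_of_neg (by linarith : 1 - α * k < 0)).congr' ?_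
    filter_upwards [eventually_ge_atTop 1] with n hn
    have hn0 : (0 : ℝ) < n := by exact_mod_cast hn
    rw [← Real.rpow_mul_natCast hn0.le, sub_eq_add_neg, Real.rpow_add hn0, Real.rpow_one, neg_mul]
  · have h := (tendsto_natCast_rpow_of_neg
      (by linarith : α * (k - 1) / 2 - 1 < 0)).const_mul ((k : ℝ) ^ 2)
    rw [mul_zero] at h
    refine h.congr' ?_
    filter_upwards [eventually_ge_atTop 1] with n hn
    have hn0 : (0 : ℝ) < n := by exact_mod_cast hn
    rw [Real.rpow_sub_one hn0.ne']
    ring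

/-- The expected number of dominating vertices of `G(n, 1 - 1 / n)` is of order `n`. -/
theorem withHighProbability_exists_isMaxIndep_card_one :
    WithHighProbability (fun n => 1 - (n : ℝ) ^ (-1 : ℝ))
      fun n G => ∃ S : Finset (Fin n), G.IsMaxIndep S ∧ S.card = 1 := by
  have hq : Tendsto (fun n : ℕ => (n : ℝ) ^ (-1 : ℝ)) atTop (𝓝 0) :=
    tendsto_natCast_rpow_of_neg (by norm_num)
  refine withHighProbability_of_le (b := fun n : ℕ =>
    (Real.exp 2 * (n : ℝ) ^ (-1 : ℝ) + (1 - (n : ℝ) ^ (-1 : ℝ))⁻¹)⁻¹) ?_ ?_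
  · have h := ((hq.const_mul (Real.exp 2)).add ((hq.const_sub 1).inv₀ (by norm_num))).inv₀
      (by norm_num)
    simpa using h
  · filter_upwards [eventually_ge_atTop 2] with n hn
    have hn0 : (0 : ℝ) < n := by exact_mod_cast (by omega : 0 < n)
    have hn2 : (2 : ℝ) ≤ n := by exact_mod_cast hn
    rw [Real.rpow_neg_one]
    have hq0 : 0 < (n : ℝ)⁻¹ := by positivity
    have hq2 : (n : ℝ)⁻¹ ≤ 1 / 2 := by
      rw [one_div]
      exact inv_anti₀ (by norm_num) hn2
    have hp0 : 0 < 1 - (n : ℝ)⁻¹ := by linarith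
    have hexp := Real.exp_neg_two_le_one_sub_pow (n := n) hq0.le hq2
      (mul_inv_cancel₀ hn0.ne').le
    have hmain := one_le_mul_erdosRenyi_real_exists_dominating (by omega : 0 < n) hp0
      (by linarith)
    have hX : (n * (1 - (n : ℝ)⁻¹) ^ n)⁻¹ ≤ Real.exp 2 * (n : ℝ)⁻¹ := by
      have h : Real.exp 2 * (n : ℝ)⁻¹ = (n * Real.exp (-2))⁻¹ := by
        rw [Real.exp_neg]
        field_simp
      rw [h]
      gcongr
    have hP : (erdosRenyi n (1 - (n : ℝ)⁻¹)).real {G | ∃ v, ∀ w, w ≠ v → G.Adj v w} ≤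
        (erdosRenyi n (1 - (n : ℝ)⁻¹)).real
          {G | ∃ S : Finset (Fin n), G.IsMaxIndep S ∧ S.card = 1} := by
      refine measureReal_mono fun G ⟨v, hv⟩ => ⟨{v}, ⟨by simp, fun w hw => ?_⟩, by simp⟩
      exact ⟨v, by simp, (hv w (by simpa using hw)).symm⟩
    rw [inv_le_iff_one_le_mul₀' (by positivity)]
    refine hmain.trans ?_
    gcongr

/-- There are maximal independent sets of the sizes `⌊1 / α⌋ + 1` and `⌊1 / α⌋ + 2`, except that for
`α = 1` the sizes are `1` and `2`. -/
theorem withHighProbability_not_isUnmixed_of_dense {α : ℝ} (h0 : 0 < α) (h2 : α < 2) :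
    WithHighProbability (fun n => 1 - (n : ℝ) ^ (-α))
      (fun _ G => ¬ (G.edgeIdeal K).IsUnmixed) := by
  rcases lt_trichotomy α 1 with h1 | rfl | h1
  · have ha : 1 < α * (⌊1 / α⌋₊ + 1) := by
      have := Nat.lt_floor_add_one (1 / α)
      rw [div_lt_iff₀ h0] at this
      linarith
    have hb : α * ⌊1 / α⌋₊ ≤ 1 := by
      have := Nat.floor_le (one_div_pos.2 h0).le
      rw [le_div_iff₀ h0] at this
      linarith
    refine withHighProbability_not_isUnmixed_of_isMaxIndep K (k := fun _ => ⌊1 / α⌋₊ + 1)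
      (l := fun _ => ⌊1 / α⌋₊ + 2) (fun n => by simp) ?_ ?_
    · exact withHighProbability_exists_isMaxIndep_of_dense h0 (by omega) (by push_cast; linarith)
        (by push_cast; linarith)
    · exact withHighProbability_exists_isMaxIndep_of_dense h0 (by omega) (by push_cast; linarith)
        (by push_cast; linarith)
  · exact withHighProbability_not_isUnmixed_of_isMaxIndep K (k := fun _ => 1) (l := fun _ => 2)
      (fun n => by simp) withHighProbability_exists_isMaxIndep_card_one
      (withHighProbability_exists_isMaxIndep_of_dense h0 (by simp) (by norm_num) (by norm_num))
  · exact withHighProbability_not_isUnmixed_of_isMaxIndep K (k := fun _ => 1) (l := fun _ => 2)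
      (fun n => by simp)
      (withHighProbability_exists_isMaxIndep_of_dense h0 le_rfl (by simpa using h1) (by simp))
      (withHighProbability_exists_isMaxIndep_of_dense h0 (by simp) (by push_cast; linarith)
        (by push_cast; linarith))

end Regimes

theorem theorem1p4 (K : Type*) [Field K] :
    (∀ α : ℝ, 3 / 2 < α → α < 2 →
      WithHighProbability (fun n => (n : ℝ) ^ (-α)) (fun _ G => (G.edgeIdeal K).IsUnmixed)) ∧
    (∀ α : ℝ, 1 ≤ α → α < 3 / 2 →
      WithHighProbability (fun n => (n : ℝ) ^ (-α)) (fun _ G => ¬ (G.edgeIdeal K).IsUnmixed)) ∧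
    (∀ p : ℝ, 0 < p → p < 1 →
      WithHighProbability (fun _ => p) (fun _ G => ¬ (G.edgeIdeal K).IsUnmixed)) ∧
    (∀ α : ℝ, 0 < α → α < 2 → (∀ k : ℕ, 2 ≤ k → α⁻¹ ≠ k) →
      WithHighProbability (fun n => 1 - (n : ℝ) ^ (-α))
        (fun _ G => ¬ (G.edgeIdeal K).IsUnmixed)) ∧
    (∀ α : ℝ, 2 < α →
      WithHighProbability (fun n => 1 - (n : ℝ) ^ (-α))
        (fun _ G => (G.edgeIdeal K).IsUnmixed)) :=
  ⟨fun _ h _ => withHighProbability_isUnmixed_of_sparse K h,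
    fun _ h1 h2 => withHighProbability_not_isUnmixed_of_sparse K h1 h2,
    fun _ h0 h1 => withHighProbability_not_isUnmixed_of_const K h0 h1,
    fun _ h0 h2 _ => withHighProbability_not_isUnmixed_of_dense K h0 h2,
    fun _ h => withHighProbability_isUnmixed_of_dense K h⟩
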